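/- Let $0<l_0<l$, let $E,I,\rho,\varkappa,m>0$ be constants, let $k\ge 0$, and let $\psi_1,\dots,\psi_k$ be real functions on $[0,l]$ with $\psi_j''\in C^2[0,l]$ and $\operatorname{supp}\psi_j\cap\{0,l_0,l\}=\emptyset$; let $\alpha_0,\alpha_1,\dots,\alpha_k>0$. Let $\mathbb K$ be $\mathbb R$ or $\mathbb C$. Write $\mathring H^2(0,l)=\{u\in H^2(0,l): u(0)=u(l)=0\}$, and let $$X=\{(u,v,p,q)\in \mathring H^2(0,l)\times L^2(0,l)\times\mathbb K\times\mathbb K:\ p=u(l_0)\}$$ ($\mathbb K$-valued functions), which is a Hilbert space for the inner product $$\langle (u_1,v_1,p_1,q_1),(u_2,v_2,p_2,q_2)\rangle_X=\int_0^l\bigl(EI\,u_1''\bar u_2''+\rho\, v_1\bar v_2\bigr)dx+\varkappa p_1\bar p_2+m q_1\bar q_2 .$$ Let $D(\tilde A)$ be the set of all $(u,v,p,q)\in X$ such that $u\in H^4(0,l_0)\cap H^4(l_0,l)$, $u''(0)=u''(l)=0$, $u''(l_0-0)=u''(l_0+0)$, $v\in\mathring H^2(0,l)$ and $q=v(l_0)$,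 and for $\xi=(u,v,p,q)\in D(\tilde A)$ put $$\tilde A\xi=\Bigl(v,\ -\tfrac1\rho (EIu'')''+\tfrac1\rho\sum_{j=1}^k\psi_j''M_j,\ q,\ \tfrac1m(L-\varkappa p+F)\Bigr),$$ where $(EIu'')''$ is taken on $(0,l_0)$ and on $(l_0,l)$ separately, $L=EI\,\bigl(u'''(l_0-0)-u'''(l_0+0)\bigr)$, $M_j=-\alpha_j\int_0^l\psi_j''v\,dx$ and $F=-\alpha_0 q$. Then $\tilde A$ is densely defined in $X$, closed, dissipative ($\operatorname{Re}\langle\tilde A\xi,\xi\rangle_X\le0$ for all $\xi\in D(\tilde A)$) and maximal (the range of $\operatorname{Id}-\lambda\tilde A$ is $X$ for some $\lambda>0$). Moreover $\tilde A$ is the infinitesimal generator of a $C_0$-semigroup on $X$, and the Cauchy problem $\dot\xi=\tilde A\xi$, $\xi(0)=\xi_0$, is well-posed: for every $\xi_0\in X$ there is exactly one mild solution on $[0,\infty)$, that is, a continuous $\xi:[0,\infty)\to X$ with $\int_0^t\xi(s)\,ds\in D(\tilde A)$ and $\xi(t)=\xi_0+\tilde A\int_0^t\xi(s)\,ds$ for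 all $t\ge0$; it is a classical ($C^1$, $D(\tilde A)$-valued) solution if $\xi_0\in D(\tilde A)$; and for each $\tau\ge0$ there is a constant $C$ such that any two mild solutions satisfy $\|\xi(t)-\eta(t)\|_X\le C\|\xi(0)-\eta(0)\|_X$ for $0\le t\le\tau$. -/

import Mathlib

open MeasureTheory Set Filter Topology
open scoped NNReal ENNReal

noncomputable section

namespace ShakerBeam

/-! ### One-dimensional Sobolev functions -/

section Sobolev

variable {𝕜 : Type*} [RCLike 𝕜]

/-- The Lebesgue space `L²(0, l)` of `𝕜`-valued functions. -/
abbrev L2 (𝕜 : Type*) [RCLike 𝕜] (l : ℝ) : Type _ :=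
  Lp 𝕜 2 (volume.restrict (Ioo (0 : ℝ) l))

theorem memLp_of_continuousOn {a b : ℝ} {f : ℝ → 𝕜} (hf : ContinuousOn f (Icc a b)) :
    MemLp f 2 (volume.restrict (Ioo a b)) := by
  obtain ⟨C, hC⟩ := isCompact_Icc.exists_bound_of_continuousOn hf
  refine MemLp.of_bound
    ((hf.mono Ioo_subset_Icc_self).aestronglyMeasurable measurableSet_Ioo) C ?_
  filter_upwards [ae_restrict_mem measurableSet_Ioo] with x hx
  exact hC x (Ioo_subset_Icc_self hx)

/-- `d 0` belongs to the Sobolev space `H^n(a, b)` and `d 1, …, d n` are its derivatives: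
each `d j` with `j < n` is the absolutely continuous representative of the `j`-th derivative on
`[a, b]`, being an indefinite integral of `d (j + 1)`, and the derivative `d n` of highest order
is square integrable. Since the functions `d j`, `j < n`, are continuous on `[a, b]`,
their values at `a` and at `b` are the one-sided boundary values (traces). -/
structure IsSobolev (n : ℕ) (a b : ℝ) (d : ℕ → ℝ → 𝕜) : Prop where
  memLp : MemLp (d n) 2 (volume.restrict (Ioo a b))
  eq_integral : ∀ j < n, ∀ x ∈ Icc a b, d j x = d j a + ∫ t in a..x, d (j + 1) t

namespace IsSobolev

variable {n : ℕ} {a b : ℝ} {d e : ℕ → ℝ → 𝕜}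

theorem intervalIntegrable (hab : a ≤ b) (h : IsSobolev n a b d) {j : ℕ} (hj : j ≤ n) :
    IntervalIntegrable (d j) volume a b := by
  induction hj using Nat.decreasingInduction with
  | self =>
    rw [intervalIntegrable_iff_integrableOn_Ioo_of_le hab]
    exact h.memLp.integrable (by norm_num)
  | of_succ k hk ih =>
    have hc : ContinuousOn (fun x => d k a + ∫ t in a..x, d (k + 1) t) (uIcc a b) :=
      continuousOn_const.add
        (intervalIntegral.continuousOn_primitive_interval
          ((intervalIntegrable_iff' (by finiteness)).1 ih))
    refine ContinuousOn.intervalIntegrable (hc.congr fun x hx => ?_)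
    rw [uIcc_of_le hab] at hx
    exact h.eq_integral k hk x hx

theorem continuousOn (hab : a ≤ b) (h : IsSobolev n a b d) {j : ℕ} (hj : j < n) :
    ContinuousOn (d j) (Icc a b) := by
  have hc : ContinuousOn (fun x => d j a + ∫ t in a..x, d (j + 1) t) (uIcc a b) :=
    continuousOn_const.add
      (intervalIntegral.continuousOn_primitive_interval
        ((intervalIntegrable_iff' (by finiteness)).1
          (h.intervalIntegrable hab (Nat.succ_le_of_lt hj))))
  rw [uIcc_of_le hab] at hc
  exact hc.congr fun x hx => h.eq_integral j hj x hx

theorem integrable_sub (hab : a ≤ b) (h : IsSobolev n a b d) {j : ℕ} (hj : j ≤ n) {x : ℝ}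
    (hx : x ∈ Icc a b) : IntervalIntegrable (d j) volume a x :=
  (h.intervalIntegrable hab hj).mono_set (by
    rw [uIcc_of_le hab, uIcc_of_le hx.1]; exact Icc_subset_Icc_right hx.2)

theorem zero : IsSobolev n a b (0 : ℕ → ℝ → 𝕜) where
  memLp := MemLp.zero
  eq_integral := by simp

theorem add (hab : a ≤ b) (h : IsSobolev n a b d) (h' : IsSobolev n a b e) :
    IsSobolev n a b (d + e) where
  memLp := h.memLp.add h'.memLp
  eq_integral j hj x hx := by
    simp only [Pi.add_apply]
    rw [intervalIntegral.integral_add (h.integrable_sub hab hj hx) (h'.integrable_sub hab hj hx),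
      h.eq_integral j hj x hx, h'.eq_integral j hj x hx]
    ring

theorem smul (h : IsSobolev n a b d) (c : 𝕜) : IsSobolev n a b (c • d) where
  memLp := h.memLp.const_smul c
  eq_integral j hj x hx := by
    simp only [Pi.smul_apply, smul_eq_mul]
    rw [intervalIntegral.integral_const_mul, h.eq_integral j hj x hx]
    ring

theorem eqOn_zero (hab : a < b) (h : IsSobolev n a b d) {j : ℕ} (hj : j < n)
    (h0 : d j =ᵐ[volume.restrict (Ioo a b)] 0) : EqOn (d j) 0 (Icc a b) := by
  refine Measure.eqOn_Icc_of_ae_eq volume hab.ne ?_ (h.continuousOn hab.le hj) continuousOn_const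
  rwa [← restrict_Ioo_eq_restrict_Icc]

theorem ae_succ_eq_zero (hab : a < b) (h : IsSobolev n a b d) {j : ℕ} (hj : j < n)
    (h0 : d j =ᵐ[volume.restrict (Ioo a b)] 0) :
    d (j + 1) =ᵐ[volume.restrict (Ioo a b)] 0 := by
  have hz := h.eqOn_zero hab hj h0
  have hd := (h.intervalIntegrable hab.le (Nat.succ_le_of_lt hj)).ae_hasDerivAt_integral
  rw [EventuallyEq, ae_restrict_iff' measurableSet_Ioo]
  filter_upwards [hd] with x hx hxab
  have h1 := hx (by rw [uIcc_of_le hab.le]; exact Ioo_subset_Icc_self hxab) a left_mem_uIcc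
  refine h1.unique ?_
  refine (hasDerivAt_const x (0 : 𝕜)).congr_of_eventuallyEq ?_
  filter_upwards [Ioo_mem_nhds hxab.1 hxab.2] with y hy
  have hy' := Ioo_subset_Icc_self hy
  have := h.eq_integral j hj y hy'
  rw [hz hy', hz (left_mem_Icc.2 hab.le)] at this
  simpa using this.symm

/-- The derivatives of a Sobolev function are determined by the function. -/
theorem ae_eq_zero (hab : a < b) (h : IsSobolev n a b d)
    (h0 : d 0 =ᵐ[volume.restrict (Ioo a b)] 0) {j : ℕ} (hj : j ≤ n) :
    d j =ᵐ[volume.restrict (Ioo a b)] 0 := by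
  induction j with
  | zero => exact h0
  | succ k ih => exact h.ae_succ_eq_zero hab hj (ih (by lia))

end IsSobolev

/-- `u ∈ L²(0, l)` belongs to `H²(0, l) ∩ H¹₀(0, l)`, that is, `u ∈ H²(0, l)` and
`u(0) = u(l) = 0`; the functions `d 0`, `d 1`, `d 2` are (representatives of) `u`, `u'`, `u''`. -/
structure IsH2Zero (l : ℝ) (u : L2 𝕜 l) (d : ℕ → ℝ → 𝕜) : Prop where
  sobolev : IsSobolev 2 0 l d
  ae_eq : u =ᵐ[volume.restrict (Ioo 0 l)] d 0
  left : d 0 0 = 0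
  right : d 0 l = 0

namespace IsH2Zero

variable {l : ℝ} {u w : L2 𝕜 l} {d e : ℕ → ℝ → 𝕜}

theorem zero : IsH2Zero l (0 : L2 𝕜 l) 0 where
  sobolev := IsSobolev.zero
  ae_eq := Lp.coeFn_zero _ _ _
  left := rfl
  right := rfl

theorem add (hl : 0 < l) (h : IsH2Zero l u d) (h' : IsH2Zero l w e) :
    IsH2Zero l (u + w) (d + e) where
  sobolev := h.sobolev.add hl.le h'.sobolev
  ae_eq := (Lp.coeFn_add u w).trans (h.ae_eq.add h'.ae_eq)
  left := by simp [h.left, h'.left]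
  right := by simp [h.right, h'.right]

theorem smul (h : IsH2Zero l u d) (c : 𝕜) : IsH2Zero l (c • u) (c • d) where
  sobolev := h.sobolev.smul c
  ae_eq := (Lp.coeFn_smul c u).trans (h.ae_eq.const_smul c)
  left := by simp [h.left]
  right := by simp [h.right]

theorem sub (hl : 0 < l) (h : IsH2Zero l u d) (h' : IsH2Zero l w e) :
    IsH2Zero l (u - w) (d + (-1 : 𝕜) • e) := by
  have := h.add hl (h'.smul (-1 : 𝕜))
  rwa [neg_one_smul 𝕜 w, ← sub_eq_add_neg] at this

theorem ae_eq_two (hl : 0 < l) (h : IsH2Zero l u d) (h' : IsH2Zero l u e) :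
    d 2 =ᵐ[volume.restrict (Ioo 0 l)] e 2 := by
  have hs := h.sub hl h'
  have h2 := hs.sobolev.ae_eq_zero hl
    (hs.ae_eq.symm.trans (by rw [sub_self]; exact Lp.coeFn_zero _ _ _)) le_rfl
  filter_upwards [h2] with x hx
  simpa [sub_eq_zero, ← sub_eq_add_neg] using hx

theorem eqOn (hl : 0 < l) (h : IsH2Zero l u d) (h' : IsH2Zero l u e) :
    EqOn (d 0) (e 0) (Icc 0 l) := by
  have hs := h.sub hl h'
  have h2 := hs.sobolev.eqOn_zero hl two_pos
    (hs.ae_eq.symm.trans (by rw [sub_self]; exact Lp.coeFn_zero _ _ _))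
  intro x hx
  simpa [sub_eq_zero, ← sub_eq_add_neg] using h2 hx

theorem norm_le (hl : 0 < l) (h : IsH2Zero l u d) {x : ℝ} (hx : x ∈ Icc 0 l) :
    ‖d 0 x‖ ≤ 2 * l * ∫ t in (0 : ℝ)..l, ‖d 2 t‖ := by
  set K := ∫ t in (0 : ℝ)..l, ‖d 2 t‖ with hK
  have hi2 := h.sobolev.intervalIntegrable hl.le (le_refl 2)
  have hb : ∀ t ∈ Icc 0 l, ‖∫ s in (0 : ℝ)..t, d 2 s‖ ≤ K := fun t ht =>
    (intervalIntegral.norm_integral_le_integral_norm ht.1).trans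
      (intervalIntegral.integral_mono_interval le_rfl ht.1 ht.2
        (Eventually.of_forall fun _ => norm_nonneg _) hi2.norm)
  have hK0 : 0 ≤ K := (norm_nonneg _).trans (hb 0 (left_mem_Icc.2 hl.le))
  have key : ∀ y ∈ Icc 0 l, ‖d 0 y - (y : ℝ) • d 1 0‖ ≤ K * y := fun y hy => by
    have h1 : d 0 y - (y : ℝ) • d 1 0 = ∫ t in (0 : ℝ)..y, (d 1 t - d 1 0) := by
      rw [h.sobolev.eq_integral 0 two_pos y hy, h.left,
        intervalIntegral.integral_sub (h.sobolev.integrable_sub hl.le one_le_two hy)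
          intervalIntegrable_const]
      simp
    rw [h1]
    refine (intervalIntegral.norm_integral_le_of_norm_le_const (C := K) fun t ht => ?_).trans
      (by rw [sub_zero, abs_of_nonneg hy.1])
    rw [uIoc_of_le hy.1] at ht
    have ht' : t ∈ Icc 0 l := ⟨ht.1.le, ht.2.trans hy.2⟩
    rw [h.sobolev.eq_integral 1 one_lt_two t ht', add_sub_cancel_left]
    exact hb t ht'
  have hl' := key l (right_mem_Icc.2 hl.le)
  rw [h.right, zero_sub, norm_neg, norm_smul, Real.norm_of_nonneg hl.le] at hl'
  have hx' := key x hx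
  have h3 : ‖d 0 x‖ ≤ ‖d 0 x - (x : ℝ) • d 1 0‖ + ‖(x : ℝ) • d 1 0‖ := by
    simpa using norm_add_le (d 0 x - (x : ℝ) • d 1 0) ((x : ℝ) • d 1 0)
  rw [norm_smul, Real.norm_of_nonneg hx.1] at h3
  have h4 : x * ‖d 1 0‖ ≤ l * ‖d 1 0‖ := mul_le_mul_of_nonneg_right hx.2 (norm_nonneg _)
  have h5 : K * x ≤ K * l := mul_le_mul_of_nonneg_left hx.2 hK0
  linarith

theorem eq_zero (hl : 0 < l) (h : IsH2Zero l u d)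
    (h0 : d 2 =ᵐ[volume.restrict (Ioo 0 l)] 0) : EqOn (d 0) 0 (Icc 0 l) := by
  intro x hx
  have h1 := h.norm_le hl hx
  have h2 : ∫ t in (0 : ℝ)..l, ‖d 2 t‖ = 0 := by
    rw [intervalIntegral.integral_of_le hl.le, ← restrict_Ioo_eq_restrict_Ioc]
    refine (integral_congr_ae (g := fun _ => (0 : ℝ)) ?_).trans (by simp)
    filter_upwards [h0] with x hx
    simp [hx]
  rw [h2, mul_zero] at h1
  simpa using h1

/-- Every `g ∈ L²(0, l)` is the second derivative of a function in `H²(0, l) ∩ H¹₀(0, l)`. -/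
theorem exists_of_L2 (hl : 0 < l) (g : L2 𝕜 l) :
    ∃ (u : L2 𝕜 l) (d : ℕ → ℝ → 𝕜), IsH2Zero l u d ∧ d 2 = g := by
  have hg : IntervalIntegrable g volume 0 l := by
    rw [intervalIntegrable_iff_integrableOn_Ioo_of_le hl.le]
    exact (Lp.memLp g).integrable (by norm_num)
  set G : ℝ → 𝕜 := fun x => ∫ t in (0 : ℝ)..x, g t with hG
  set c : 𝕜 := -((l : 𝕜)⁻¹ * ∫ t in (0 : ℝ)..l, G t) with hc
  have hGc : ContinuousOn G (Icc 0 l) := by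
    have := intervalIntegral.continuousOn_primitive_interval
      ((intervalIntegrable_iff' (by finiteness)).1 hg)
    rwa [uIcc_of_le hl.le] at this
  have hd1 : ContinuousOn (fun x => c + G x) (Icc 0 l) := continuousOn_const.add hGc
  set F : ℝ → 𝕜 := fun x => ∫ t in (0 : ℝ)..x, (c + G t) with hF
  have hi1 : IntervalIntegrable (fun x => c + G x) volume 0 l :=
    ContinuousOn.intervalIntegrable (by rwa [uIcc_of_le hl.le])
  have hFc : ContinuousOn F (Icc 0 l) := by
    have := intervalIntegral.continuousOn_primitive_interval
      ((intervalIntegrable_iff' (by finiteness)).1 hi1)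
    rwa [uIcc_of_le hl.le] at this
  have hFm : MemLp F 2 (volume.restrict (Ioo 0 l)) :=
    memLp_of_continuousOn hFc
  refine ⟨hFm.toLp F, fun j => if j = 0 then F else if j = 1 then fun x => c + G x else g,
    ⟨⟨Lp.memLp g, ?_⟩, hFm.coeFn_toLp, by simp [hF], ?_⟩, rfl⟩
  · intro j hj x hx
    interval_cases j
    · simp [hF]
    · simp [hG]
  · have hlne : (l : 𝕜) ≠ 0 := by exact_mod_cast hl.ne'
    simp only [if_true, hF]
    rw [intervalIntegral.integral_add intervalIntegrable_const
      (ContinuousOn.intervalIntegrable (by rwa [uIcc_of_le hl.le])),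
      intervalIntegral.integral_const, hc, RCLike.real_smul_eq_coe_mul]
    field_simp
    simp

end IsH2Zero

end Sobolev

/-! ### The beam with shaker and its state space -/

/-- Mechanical parameters of a simply supported beam of length `l` with constant Young modulus
`E`, cross-section moment of inertia `I` and mass per unit length `ρ`, carrying at the interior
point `l₀` a shaker of mass `m` and stiffness `κ`. -/
structure Beam where
  l : ℝ
  l₀ : ℝ
  E : ℝ
  I : ℝ
  ρ : ℝ
  κ : ℝ
  m : ℝ
  l₀_pos : 0 < l₀
  l₀_lt : l₀ < l
  E_pos : 0 < E
  I_pos : 0 < I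
  ρ_pos : 0 < ρ
  κ_pos : 0 < κ
  m_pos : 0 < m

namespace Beam

variable (B : Beam)

theorem l_pos : 0 < B.l := B.l₀_pos.trans B.l₀_lt

theorem l₀_mem : B.l₀ ∈ Icc 0 B.l := ⟨B.l₀_pos.le, B.l₀_lt.le⟩

/-- The quadruples `(u, v, p, q)` with `u ∈ H²(0, l) ∩ H¹₀(0, l)`, `v ∈ L²(0, l)`, `p, q ∈ 𝕜`
and `p = u(l₀)` (the position of the shaker is the deflection of the beam at `l₀`). -/
def stateSubmodule (𝕜 : Type*) [RCLike 𝕜] :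
    Submodule 𝕜 (L2 𝕜 B.l × L2 𝕜 B.l × 𝕜 × 𝕜) where
  carrier := {ξ | ∃ d, IsH2Zero B.l ξ.1 d ∧ ξ.2.2.1 = d 0 B.l₀}
  zero_mem' := ⟨0, IsH2Zero.zero, rfl⟩
  add_mem' := by
    rintro ξ η ⟨d, hd, hp⟩ ⟨e, he, hq⟩
    exact ⟨d + e, hd.add B.l_pos he, by simp [hp, hq]⟩
  smul_mem' := by
    rintro c ξ ⟨d, hd, hp⟩
    exact ⟨c • d, hd.smul c, by simp [hp]⟩

/-- The state space `X`. Its norm is the energy norm given below (not that of the product). -/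
def X (𝕜 : Type*) [RCLike 𝕜] : Type _ := B.stateSubmodule 𝕜

namespace X

variable {B} {𝕜 : Type*} [RCLike 𝕜]

instance : AddCommGroup (B.X 𝕜) := inferInstanceAs (AddCommGroup (B.stateSubmodule 𝕜))

instance : Module 𝕜 (B.X 𝕜) := inferInstanceAs (Module 𝕜 (B.stateSubmodule 𝕜))

/-- The deflection. -/
def u : B.X 𝕜 →ₗ[𝕜] L2 𝕜 B.l := LinearMap.fst _ _ _ ∘ₗ (B.stateSubmodule 𝕜).subtype

/-- The velocity of the beam. -/
def v : B.X 𝕜 →ₗ[𝕜] L2 𝕜 B.l :=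
  LinearMap.fst _ _ _ ∘ₗ LinearMap.snd _ _ _ ∘ₗ (B.stateSubmodule 𝕜).subtype

/-- The position of the shaker. -/
def p : B.X 𝕜 →ₗ[𝕜] 𝕜 :=
  LinearMap.fst _ _ _ ∘ₗ LinearMap.snd _ _ _ ∘ₗ LinearMap.snd _ _ _ ∘ₗ
    (B.stateSubmodule 𝕜).subtype

/-- The velocity of the shaker. -/
def q : B.X 𝕜 →ₗ[𝕜] 𝕜 :=
  LinearMap.snd _ _ _ ∘ₗ LinearMap.snd _ _ _ ∘ₗ LinearMap.snd _ _ _ ∘ₗ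
    (B.stateSubmodule 𝕜).subtype

theorem exists_rep (ξ : B.X 𝕜) : ∃ d, IsH2Zero B.l (u ξ) d ∧ p ξ = d 0 B.l₀ := ξ.2

theorem ext {ξ η : B.X 𝕜} (hu : u ξ = u η) (hv : v ξ = v η) (hp : p ξ = p η)
    (hq : q ξ = q η) : ξ = η :=
  Subtype.ext (Prod.ext hu (Prod.ext hv (Prod.ext hp hq)))

/-- The second derivative `u''` of the deflection. -/
def d2u : B.X 𝕜 →ₗ[𝕜] L2 𝕜 B.l where
  toFun ξ := ((exists_rep ξ).choose_spec.1.sobolev.memLp).toLp _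
  map_add' ξ η := by
    rw [← MemLp.toLp_add]
    refine MemLp.toLp_congr _ _ ?_
    exact (exists_rep (ξ + η)).choose_spec.1.ae_eq_two B.l_pos (by
      rw [map_add]
      exact (exists_rep ξ).choose_spec.1.add B.l_pos (exists_rep η).choose_spec.1)
  map_smul' c ξ := by
    rw [RingHom.id_apply, ← MemLp.toLp_const_smul]
    refine MemLp.toLp_congr _ _ ?_
    exact (exists_rep (c • ξ)).choose_spec.1.ae_eq_two B.l_pos (by
      rw [map_smul]
      exact (exists_rep ξ).choose_spec.1.smul c)

theorem d2u_ae_eq (ξ : B.X 𝕜) {d : ℕ → ℝ → 𝕜} (hd : IsH2Zero B.l (u ξ) d) :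
    d2u ξ =ᵐ[volume.restrict (Ioo 0 B.l)] d 2 :=
  (MemLp.coeFn_toLp (exists_rep ξ).choose_spec.1.sobolev.memLp).trans ((exists_rep ξ).choose_spec.1.ae_eq_two B.l_pos hd)

theorem eq_zero_of_d2u {ξ : B.X 𝕜} (h : d2u ξ = 0) : u ξ = 0 ∧ p ξ = 0 := by
  obtain ⟨d, hd, hp⟩ := exists_rep ξ
  have h2 : d 2 =ᵐ[volume.restrict (Ioo 0 B.l)] 0 :=
    (d2u_ae_eq ξ hd).symm.trans (by rw [h]; exact Lp.coeFn_zero _ _ _)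
  have h0 := hd.eq_zero B.l_pos h2
  refine ⟨?_, by rw [hp, h0 B.l₀_mem]; rfl⟩
  refine Lp.ext (hd.ae_eq.trans ?_)
  filter_upwards [ae_restrict_mem measurableSet_Ioo, Lp.coeFn_zero 𝕜 2 (volume.restrict (Ioo 0 B.l))]
    with x hx h
  rw [h, h0 (Ioo_subset_Icc_self hx)]

/-- The energy inner product
`∫₀ˡ (E I u₁'' ū₂'' + ρ v₁ v̄₂) dx + κ p₁ p̄₂ + m q₁ q̄₂`,
written here with the conjugation on the first factor, as usual in Mathlib. -/
@[reducible] def core : InnerProductSpace.Core 𝕜 (B.X 𝕜) where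
  inner ξ η := (B.E * B.I : ℝ) * inner 𝕜 (d2u ξ) (d2u η) + (B.ρ : ℝ) * inner 𝕜 (v ξ) (v η)
    + (B.κ : ℝ) * inner 𝕜 (p ξ) (p η) + (B.m : ℝ) * inner 𝕜 (q ξ) (q η)
  conj_inner_symm ξ η := by
    simp only [map_add, map_mul, RCLike.conj_ofReal, inner_conj_symm]
  re_inner_nonneg ξ := by
    have := B.E_pos; have := B.I_pos; have := B.ρ_pos; have := B.κ_pos; have := B.m_pos
    simp only [map_add, RCLike.re_ofReal_mul, inner_self_eq_norm_sq]
    positivity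
  add_left ξ η ζ := by
    simp only [map_add, inner_add_left]; ring
  smul_left ξ η c := by
    simp only [map_smul, inner_smul_left]; ring
  definite ξ h := by
    have hEI := mul_pos B.E_pos B.I_pos
    have hρ := B.ρ_pos; have hκ := B.κ_pos; have hm := B.m_pos
    have h' := congrArg RCLike.re h
    simp only [map_add, RCLike.re_ofReal_mul, inner_self_eq_norm_sq, map_zero] at h'
    have h1 : 0 ≤ B.E * B.I * ‖d2u ξ‖ ^ 2 := by positivity
    have h2 : 0 ≤ B.ρ * ‖v ξ‖ ^ 2 := by positivity
    have h3 : 0 ≤ B.κ * ‖p ξ‖ ^ 2 := by positivity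
    have h4 : 0 ≤ B.m * ‖q ξ‖ ^ 2 := by positivity
    have e1 : B.E * B.I * ‖d2u ξ‖ ^ 2 = 0 := by linarith
    have e2 : B.ρ * ‖v ξ‖ ^ 2 = 0 := by linarith
    have e4 : B.m * ‖q ξ‖ ^ 2 = 0 := by linarith
    have f1 : d2u ξ = 0 := by simpa [hEI.ne'] using e1
    have f2 : v ξ = 0 := by simpa [hρ.ne'] using e2
    have f4 : q ξ = 0 := by simpa [hm.ne'] using e4
    obtain ⟨f0, f3⟩ := eq_zero_of_d2u f1
    exact ext (by simp [f0]) (by simp [f2]) (by simp [f3]) (by simp [f4])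

instance : NormedAddCommGroup (B.X 𝕜) :=
  InnerProductSpace.Core.toNormedAddCommGroup (𝕜 := 𝕜) (cd := core)

instance : InnerProductSpace 𝕜 (B.X 𝕜) := InnerProductSpace.ofCore core.toCore

instance : NormedSpace ℝ (B.X 𝕜) := NormedSpace.restrictScalars ℝ 𝕜 (B.X 𝕜)

instance : IsScalarTower ℝ 𝕜 (B.X 𝕜) := ⟨fun r c ξ => by
  rw [RCLike.real_smul_eq_coe_mul, mul_smul, ← RCLike.algebraMap_eq_ofReal]; rfl⟩

theorem inner_def (ξ η : B.X 𝕜) :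
    inner 𝕜 ξ η = (B.E * B.I : ℝ) * inner 𝕜 (d2u ξ) (d2u η) + (B.ρ : ℝ) * inner 𝕜 (v ξ) (v η)
    + (B.κ : ℝ) * inner 𝕜 (p ξ) (p η) + (B.m : ℝ) * inner 𝕜 (q ξ) (q η) := rfl

theorem norm_sq (ξ : B.X 𝕜) :
    ‖ξ‖ ^ 2 = B.E * B.I * ‖d2u ξ‖ ^ 2 + B.ρ * ‖v ξ‖ ^ 2 + B.κ * ‖p ξ‖ ^ 2 + B.m * ‖q ξ‖ ^ 2 := by
  rw [← inner_self_eq_norm_sq (𝕜 := 𝕜), inner_def]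
  simp only [map_add, RCLike.re_ofReal_mul, inner_self_eq_norm_sq]

theorem norm_p_le : ∃ C : ℝ, 0 ≤ C ∧ ∀ ξ : B.X 𝕜, ‖p ξ‖ ≤ C * ‖d2u ξ‖ := by
  have : IsFiniteMeasure (volume.restrict (Ioo 0 B.l)) := inferInstance
  let one : Lp ℝ 2 (volume.restrict (Ioo 0 B.l)) := (memLp_const (1 : ℝ)).toLp _
  refine ⟨2 * B.l * ‖one‖, by have := B.l_pos; positivity, fun ξ => ?_⟩
  obtain ⟨d, hd, hp⟩ := exists_rep ξ
  rw [hp, mul_assoc]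
  refine (hd.norm_le B.l_pos B.l₀_mem).trans
    (mul_le_mul_of_nonneg_left ?_ (by have := B.l_pos; positivity))
  have hn : MemLp (fun x => ‖d2u ξ x‖) 2 (volume.restrict (Ioo 0 B.l)) := (Lp.memLp _).norm
  have h1 : ∫ t in (0 : ℝ)..B.l, ‖d 2 t‖ = inner ℝ one (hn.toLp _) := by
    rw [L2.inner_def, intervalIntegral.integral_of_le B.l_pos.le, ← restrict_Ioo_eq_restrict_Ioc]
    refine integral_congr_ae ?_
    filter_upwards [d2u_ae_eq ξ hd, hn.coeFn_toLp,
      (memLp_const (μ := volume.restrict (Ioo 0 B.l)) (p := 2) (1 : ℝ)).coeFn_toLp] with x h h' h''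
    simp only [one]
    rw [h', h'', h]
    simp
  rw [h1]
  refine (real_inner_le_norm _ _).trans (mul_le_mul_of_nonneg_left ?_ (norm_nonneg _))
  rw [Lp.norm_toLp, Lp.norm_def, eLpNorm_norm]

theorem exists_of (g f : L2 𝕜 B.l) (c : 𝕜) : ∃ ξ : B.X 𝕜, d2u ξ = g ∧ v ξ = f ∧ q ξ = c := by
  obtain ⟨w, d, hd, h2⟩ := IsH2Zero.exists_of_L2 B.l_pos g
  refine ⟨⟨(w, f, d 0 B.l₀, c), d, hd, rfl⟩, Lp.ext ?_, rfl, rfl⟩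
  rw [← h2]
  exact d2u_ae_eq _ hd

instance : CompleteSpace (B.X 𝕜) := by
  have hEI := mul_pos B.E_pos B.I_pos
  have hρ := B.ρ_pos; have hκ := B.κ_pos; have hm := B.m_pos
  refine Metric.complete_of_cauchySeq_tendsto fun x hx => ?_
  have aux : ∀ {F : Type _} [NormedAddCommGroup F] [NormedSpace 𝕜 F] [CompleteSpace F]
      (f : B.X 𝕜 →ₗ[𝕜] F) (c : ℝ), 0 < c → (∀ ξ, c * ‖f ξ‖ ^ 2 ≤ ‖ξ‖ ^ 2) →
      ∃ y, Tendsto (fun n => f (x n)) atTop (𝓝 y) := by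
    intro F _ _ _ f c hc hf
    refine cauchySeq_tendsto_of_complete ?_
    have hb : ∀ ξ, ‖f ξ‖ ≤ (√c)⁻¹ * ‖ξ‖ := fun ξ => by
      have := Real.sqrt_le_sqrt (hf ξ)
      rw [Real.sqrt_mul hc.le, Real.sqrt_sq (norm_nonneg _), Real.sqrt_sq (norm_nonneg _)] at this
      rw [inv_mul_eq_div, le_div_iff₀ (Real.sqrt_pos.2 hc)]
      linarith
    exact hx.map (f.mkContinuous _ hb).uniformContinuous
  have b1 : ∀ ξ : B.X 𝕜, 0 ≤ B.E * B.I * ‖d2u ξ‖ ^ 2 := fun ξ => by positivity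
  have b2 : ∀ ξ : B.X 𝕜, 0 ≤ B.ρ * ‖v ξ‖ ^ 2 := fun ξ => by positivity
  have b3 : ∀ ξ : B.X 𝕜, 0 ≤ B.κ * ‖p ξ‖ ^ 2 := fun ξ => by positivity
  have b4 : ∀ ξ : B.X 𝕜, 0 ≤ B.m * ‖q ξ‖ ^ 2 := fun ξ => by positivity
  obtain ⟨g, hg⟩ := aux d2u _ hEI fun ξ => by rw [norm_sq]; linarith [b2 ξ, b3 ξ, b4 ξ]
  obtain ⟨f, hf⟩ := aux v _ hρ fun ξ => by rw [norm_sq]; linarith [b1 ξ, b3 ξ, b4 ξ]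
  obtain ⟨c, hc⟩ := aux q _ hm fun ξ => by rw [norm_sq]; linarith [b1 ξ, b2 ξ, b3 ξ]
  obtain ⟨ξ, h1, h2, h4⟩ := exists_of (B := B) g f c
  obtain ⟨C, hC, hp⟩ := norm_p_le (B := B) (𝕜 := 𝕜)
  refine ⟨ξ, ?_⟩
  rw [tendsto_iff_norm_sub_tendsto_zero] at hg hf hc ⊢
  have hp' : Tendsto (fun n => ‖p (x n - ξ)‖) atTop (𝓝 0) := by
    refine squeeze_zero (fun _ => norm_nonneg _) (fun n => hp (x n - ξ)) ?_
    simpa [map_sub, h1] using hg.const_mul C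
  have hs : Tendsto (fun n => ‖x n - ξ‖ ^ 2) atTop (𝓝 0) := by
    simp only [norm_sq]
    simpa [map_sub, h1, h2, h4] using
      ((((hg.pow 2).const_mul (B.E * B.I)).add ((hf.pow 2).const_mul B.ρ)).add
        ((hp'.pow 2).const_mul B.κ)).add ((hc.pow 2).const_mul B.m)
  have := hs.sqrt
  simpa using this

end X

/-! ### The closed-loop operator -/

/-- Data of the feedback law: the shape functions `ψ j` of the `k` piezo actuators (only their
restrictions to `[0, l]` matter), with `ψ j'' ∈ C²[0, l]` and `supp (ψ j) ∩ {0, l₀, l} = ∅`,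
and the positive gains `α j` and `α₀`. -/
structure Feedback (k : ℕ) where
  ψ : Fin k → ℝ → ℝ
  α : Fin k → ℝ
  α₀ : ℝ
  contDiffOn : ∀ j, ContDiffOn ℝ 4 (ψ j) (Icc 0 B.l)
  disjoint_supp : ∀ j,
    Disjoint (closure (Function.support (ψ j) ∩ Icc 0 B.l)) ({0, B.l₀, B.l} : Set ℝ)
  α_pos : ∀ j, 0 < α j
  α₀_pos : 0 < α₀

namespace Feedback

variable {B} {k : ℕ} (K : B.Feedback k) {𝕜 : Type*} [RCLike 𝕜]

/-- The second derivative `ψ j''` on `[0, l]`. -/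
def ddψ (j : Fin k) (x : ℝ) : ℝ := iteratedDerivWithin 2 (K.ψ j) (Icc 0 B.l) x

/-- The torque density `M j = - α j ∫₀ˡ ψ j''(x) v(x) dx`. -/
def torque (ξ : B.X 𝕜) (j : Fin k) : 𝕜 :=
  -(K.α j : 𝕜) * ∫ x in Ioo 0 B.l, (K.ddψ j x : 𝕜) * X.v ξ x

/-- The control force `F = - α₀ q`. -/
def force (ξ : B.X 𝕜) : 𝕜 := -(K.α₀ : 𝕜) * X.q ξ

theorem integrable_ddψ_mul (j : Fin k) (f : L2 𝕜 B.l) :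
    Integrable (fun x => (K.ddψ j x : 𝕜) * f x) (volume.restrict (Ioo 0 B.l)) := by
  have hc : ContinuousOn (fun x => (K.ddψ j x : 𝕜)) (Icc 0 B.l) :=
    RCLike.continuous_ofReal.comp_continuousOn
      ((K.contDiffOn j).continuousOn_iteratedDerivWithin (m := 2) (by norm_num)
        (uniqueDiffOn_Icc B.l_pos))
  exact (memLp_of_continuousOn hc).integrable_mul (Lp.memLp f)

theorem torque_add (ξ η : B.X 𝕜) (j : Fin k) :
    K.torque (ξ + η) j = K.torque ξ j + K.torque η j := by
  have : ∫ x in Ioo 0 B.l, (K.ddψ j x : 𝕜) * X.v (ξ + η) x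
      = ∫ x in Ioo 0 B.l, ((K.ddψ j x : 𝕜) * X.v ξ x + (K.ddψ j x : 𝕜) * X.v η x) := by
    refine integral_congr_ae ?_
    rw [map_add]
    filter_upwards [Lp.coeFn_add (X.v ξ) (X.v η)] with x hx
    rw [hx, Pi.add_apply, mul_add]
  simp only [torque]
  rw [this, integral_add (K.integrable_ddψ_mul j _) (K.integrable_ddψ_mul j _), mul_add]

theorem torque_smul (c : 𝕜) (ξ : B.X 𝕜) (j : Fin k) :
    K.torque (c • ξ) j = c * K.torque ξ j := by
  have : ∫ x in Ioo 0 B.l, (K.ddψ j x : 𝕜) * X.v (c • ξ) x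
      = ∫ x in Ioo 0 B.l, c * ((K.ddψ j x : 𝕜) * X.v ξ x) := by
    refine integral_congr_ae ?_
    rw [map_smul]
    filter_upwards [Lp.coeFn_smul c (X.v ξ)] with x hx
    rw [hx, Pi.smul_apply, smul_eq_mul]
    ring
  simp only [torque]
  rw [this, integral_const_mul]
  ring

/-- `ξ = (u, v, p, q)` belongs to the domain `D(Ã)`:
`u ∈ H⁴(0, l₀) ∩ H⁴(l₀, l)`, with derivatives `a j` on `[0, l₀]` and `b j` on `[l₀, l]`,
`u''(0) = u''(l) = 0`, `u''(l₀ - 0) = u''(l₀ + 0)`, `v ∈ H²(0, l) ∩ H¹₀(0, l)`, `q = v(l₀)`.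
The condition `p = u(l₀)` holds for all elements of `X`. -/
structure InDomain (ξ : B.X 𝕜) (a b : ℕ → ℝ → 𝕜) : Prop where
  sobolev_left : IsSobolev 4 0 B.l₀ a
  sobolev_right : IsSobolev 4 B.l₀ B.l b
  u_left : X.u ξ =ᵐ[volume.restrict (Ioo 0 B.l₀)] a 0
  u_right : X.u ξ =ᵐ[volume.restrict (Ioo B.l₀ B.l)] b 0
  bc_zero : a 2 0 = 0
  bc_l : b 2 B.l = 0
  interface : a 2 B.l₀ = b 2 B.l₀
  v_mem : ∃ e, IsH2Zero B.l (X.v ξ) e ∧ X.q ξ = e 0 B.l₀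

/-- `η = Ã ξ`, for `ξ = (u, v, p, q)` in the domain, with `a`, `b` as in `InDomain`:
`η = (v, -(1/ρ) (E I u'')'' + (1/ρ) ∑ j, ψ j'' M j, q, (1/m) (L - κ p + F))`, where
`L = E I (u'''(l₀ - 0) - u'''(l₀ + 0))` and `M j`, `F` are given by the feedback law. -/
structure IsImage (ξ η : B.X 𝕜) (a b : ℕ → ℝ → 𝕜) : Prop where
  u_eq : X.u η = X.v ξ
  v_left : X.v η =ᵐ[volume.restrict (Ioo 0 B.l₀)] fun x =>
    -(1 / (B.ρ : 𝕜)) * ((B.E : 𝕜) * B.I * a 4 x)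
      + 1 / (B.ρ : 𝕜) * ∑ j, (K.ddψ j x : 𝕜) * K.torque ξ j
  v_right : X.v η =ᵐ[volume.restrict (Ioo B.l₀ B.l)] fun x =>
    -(1 / (B.ρ : 𝕜)) * ((B.E : 𝕜) * B.I * b 4 x)
      + 1 / (B.ρ : 𝕜) * ∑ j, (K.ddψ j x : 𝕜) * K.torque ξ j
  p_eq : X.p η = X.q ξ
  q_eq : X.q η = 1 / (B.m : 𝕜) *
    ((B.E : 𝕜) * B.I * (a 3 B.l₀ - b 3 B.l₀) - B.κ * X.p ξ + K.force ξ)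

theorem ae_left {P : ℝ → Prop} (h : ∀ᵐ x ∂volume.restrict (Ioo 0 B.l), P x) :
    ∀ᵐ x ∂volume.restrict (Ioo 0 B.l₀), P x :=
  ae_mono (Measure.restrict_mono (Ioo_subset_Ioo_right B.l₀_lt.le) le_rfl) h

theorem ae_right {P : ℝ → Prop} (h : ∀ᵐ x ∂volume.restrict (Ioo 0 B.l), P x) :
    ∀ᵐ x ∂volume.restrict (Ioo B.l₀ B.l), P x :=
  ae_mono (Measure.restrict_mono (Ioo_subset_Ioo_left B.l₀_pos.le) le_rfl) h

/-- The graph `{(ξ, Ã ξ) : ξ ∈ D(Ã)}` of the closed-loop operator. -/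
def closedLoopGraph (𝕜 : Type*) [RCLike 𝕜] : Submodule 𝕜 (B.X 𝕜 × B.X 𝕜) where
  carrier := {z | ∃ a b, InDomain z.1 a b ∧ K.IsImage z.1 z.2 a b}
  zero_mem' := by
    have h0 := Lp.coeFn_zero 𝕜 2 (volume.restrict (Ioo 0 B.l))
    refine ⟨0, 0, ⟨.zero, .zero, ?_, ?_, rfl, rfl, rfl, 0, ?_, ?_⟩, ⟨?_, ?_, ?_, ?_, ?_⟩⟩
    · simp only [Prod.fst_zero, map_zero]
      exact ae_left h0
    · simp only [Prod.fst_zero, map_zero]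
      exact ae_right h0
    · simpa using IsH2Zero.zero
    · simp
    · simp
    · have ht : ∀ j, K.torque (0 : B.X 𝕜) j = 0 := fun j => by
        simpa using K.torque_smul (0 : 𝕜) 0 j
      filter_upwards [ae_left h0] with x hx
      simpa [ht] using hx
    · have ht : ∀ j, K.torque (0 : B.X 𝕜) j = 0 := fun j => by
        simpa using K.torque_smul (0 : 𝕜) 0 j
      filter_upwards [ae_right h0] with x hx
      simpa [ht] using hx
    · simp
    · simp [force]
  add_mem' := by
    rintro ⟨ξ, η⟩ ⟨ξ', η'⟩ ⟨a, b, hd, hi⟩ ⟨a', b', hd', hi'⟩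
    obtain ⟨e, he, hq⟩ := hd.v_mem
    obtain ⟨e', he', hq'⟩ := hd'.v_mem
    have hu := Lp.coeFn_add (X.u ξ) (X.u ξ')
    have hv := Lp.coeFn_add (X.v η) (X.v η')
    refine ⟨a + a', b + b', ⟨hd.sobolev_left.add B.l₀_pos.le hd'.sobolev_left,
      hd.sobolev_right.add B.l₀_lt.le hd'.sobolev_right, ?_, ?_, ?_, ?_, ?_, e + e', ?_, ?_⟩,
      ⟨?_, ?_, ?_, ?_, ?_⟩⟩
    · simp only [Prod.mk_add_mk, map_add]
      exact EventuallyEq.trans (ae_left hu) (hd.u_left.add hd'.u_left)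
    · simp only [Prod.mk_add_mk, map_add]
      exact EventuallyEq.trans (ae_right hu) (hd.u_right.add hd'.u_right)
    · simp [hd.bc_zero, hd'.bc_zero]
    · simp [hd.bc_l, hd'.bc_l]
    · simp [hd.interface, hd'.interface]
    · simpa using he.add B.l_pos he'
    · simp [hq, hq']
    · simp [hi.u_eq, hi'.u_eq]
    · simp only [Prod.mk_add_mk, map_add]
      filter_upwards [ae_left hv, hi.v_left, hi'.v_left] with x h h1 h2
      rw [h, Pi.add_apply, h1, h2]
      simp only [torque_add, mul_add, Finset.sum_add_distrib, Pi.add_apply]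
      ring
    · simp only [Prod.mk_add_mk, map_add]
      filter_upwards [ae_right hv, hi.v_right, hi'.v_right] with x h h1 h2
      rw [h, Pi.add_apply, h1, h2]
      simp only [torque_add, mul_add, Finset.sum_add_distrib, Pi.add_apply]
      ring
    · simp [hi.p_eq, hi'.p_eq]
    · simp only [Prod.mk_add_mk, map_add, hi.q_eq, hi'.q_eq, force, Pi.add_apply]
      ring
  smul_mem' := by
    rintro c ⟨ξ, η⟩ ⟨a, b, hd, hi⟩
    obtain ⟨e, he, hq⟩ := hd.v_mem
    have hu := Lp.coeFn_smul c (X.u ξ)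
    have hv := Lp.coeFn_smul c (X.v η)
    have hs : ∀ x, ∑ j, (K.ddψ j x : 𝕜) * K.torque (c • ξ) j
        = c * ∑ j, (K.ddψ j x : 𝕜) * K.torque ξ j := fun x => by
      rw [Finset.mul_sum]
      exact Finset.sum_congr rfl fun j _ => by rw [torque_smul]; ring
    refine ⟨c • a, c • b, ⟨hd.sobolev_left.smul c, hd.sobolev_right.smul c, ?_, ?_, ?_, ?_, ?_,
      c • e, ?_, ?_⟩, ⟨?_, ?_, ?_, ?_, ?_⟩⟩
    · simp only [Prod.smul_mk, map_smul]
      exact EventuallyEq.trans (ae_left hu) (hd.u_left.const_smul c)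
    · simp only [Prod.smul_mk, map_smul]
      exact EventuallyEq.trans (ae_right hu) (hd.u_right.const_smul c)
    · simp [hd.bc_zero]
    · simp [hd.bc_l]
    · simp [hd.interface]
    · simpa using he.smul c
    · simp [hq]
    · simp [hi.u_eq]
    · simp only [Prod.smul_mk, map_smul]
      filter_upwards [ae_left hv, hi.v_left] with x h h1
      rw [h, Pi.smul_apply, h1, hs]
      simp only [Pi.smul_apply, smul_eq_mul]
      ring
    · simp only [Prod.smul_mk, map_smul]
      filter_upwards [ae_right hv, hi.v_right] with x h h1
      rw [h, Pi.smul_apply, h1, hs]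
      simp only [Pi.smul_apply, smul_eq_mul]
      ring
    · simp [hi.p_eq]
    · simp only [Prod.smul_mk, map_smul, hi.q_eq, force, Pi.smul_apply, smul_eq_mul]
      ring

/-- `Ã ξ` is determined by `ξ`. -/
theorem snd_eq_zero_of_mem_graph (z : B.X 𝕜 × B.X 𝕜) (hz : z ∈ K.closedLoopGraph 𝕜)
    (h0 : z.1 = 0) : z.2 = 0 := by
  obtain ⟨ξ, η⟩ := z
  obtain ⟨a, b, hd, hi⟩ := hz
  dsimp only at h0 hd hi ⊢
  subst h0
  have hz := Lp.coeFn_zero 𝕜 2 (volume.restrict (Ioo 0 B.l))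
  have ht : ∀ j, K.torque (0 : B.X 𝕜) j = 0 := fun j => by
    simpa using K.torque_smul (0 : 𝕜) 0 j
  have ha : a 0 =ᵐ[volume.restrict (Ioo 0 B.l₀)] 0 :=
    hd.u_left.symm.trans (by rw [map_zero]; exact ae_left hz)
  have hb : b 0 =ᵐ[volume.restrict (Ioo B.l₀ B.l)] 0 :=
    hd.u_right.symm.trans (by rw [map_zero]; exact ae_right hz)
  have haj : ∀ j ≤ 4, a j =ᵐ[volume.restrict (Ioo 0 B.l₀)] 0 := fun j hj =>
    hd.sobolev_left.ae_eq_zero B.l₀_pos ha hj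
  have hbj : ∀ j ≤ 4, b j =ᵐ[volume.restrict (Ioo B.l₀ B.l)] 0 := fun j hj =>
    hd.sobolev_right.ae_eq_zero B.l₀_lt hb hj
  have ha3 : a 3 B.l₀ = 0 := hd.sobolev_left.eqOn_zero B.l₀_pos (j := 3) (by norm_num)
    (haj 3 (by norm_num)) (right_mem_Icc.2 B.l₀_pos.le)
  have hb3 : b 3 B.l₀ = 0 := hd.sobolev_right.eqOn_zero B.l₀_lt (j := 3) (by norm_num)
    (hbj 3 (by norm_num)) (left_mem_Icc.2 B.l₀_lt.le)
  refine X.ext ?_ ?_ ?_ ?_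
  · simpa using hi.u_eq
  · have h1 : ∀ᵐ x ∂volume.restrict (Ioo 0 B.l₀), X.v η x = 0 := by
      filter_upwards [hi.v_left, haj 4 le_rfl] with x h h'
      simp [h, h', ht]
    have h2 : ∀ᵐ x ∂volume.restrict (Ioo B.l₀ B.l), X.v η x = 0 := by
      filter_upwards [hi.v_right, hbj 4 le_rfl] with x h h'
      simp [h, h', ht]
    rw [map_zero]
    refine Lp.ext (EventuallyEq.trans ?_ hz.symm)
    change ∀ᵐ x ∂volume.restrict (Ioo 0 B.l), X.v η x = 0
    rw [ae_restrict_iff' measurableSet_Ioo] at h1 h2 ⊢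
    have h3 : ∀ᵐ x ∂(volume : Measure ℝ), x ≠ B.l₀ := by simp [ae_iff, measure_singleton]
    filter_upwards [h1, h2, h3] with x g1 g2 g3 hx
    rcases lt_or_gt_of_ne g3 with h | h
    · exact g1 ⟨hx.1, h⟩
    · exact g2 ⟨h, hx.2⟩
  · simpa using hi.p_eq
  · simpa [ha3, hb3, force] using hi.q_eq

/-- The closed-loop operator `Ã : D(Ã) → X`. -/
def closedLoop (𝕜 : Type*) [RCLike 𝕜] : B.X 𝕜 →ₗ.[𝕜] B.X 𝕜 :=
  (K.closedLoopGraph 𝕜).toLinearPMap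

theorem mem_graph_closedLoop {ξ η : B.X 𝕜} :
    (ξ, η) ∈ (K.closedLoop 𝕜).graph ↔ ∃ a b, InDomain ξ a b ∧ K.IsImage ξ η a b := by
  rw [closedLoop, Submodule.toLinearPMap_graph_eq _ fun z hz h => K.snd_eq_zero_of_mem_graph z hz h]
  rfl

end Feedback

end Beam

/-! ### Semigroups and the abstract Cauchy problem -/

section Semigroup

variable {𝕜 : Type*} [RCLike 𝕜] {E : Type*} [NormedAddCommGroup E]

/-- `A` is dissipative: `Re ⟨A x, x⟩ ≤ 0` on its domain. -/
def IsDissipative [InnerProductSpace 𝕜 E] (A : E →ₗ.[𝕜] E) : Prop :=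
  ∀ x : A.domain, RCLike.re (inner 𝕜 (A x) (x : E)) ≤ 0

/-- `A` is maximal: the range of `1 - lam A` is the whole space for some `lam > 0`. -/
def IsMaximal [NormedSpace 𝕜 E] (A : E →ₗ.[𝕜] E) : Prop :=
  ∃ lam : ℝ, 0 < lam ∧ ∀ y : E, ∃ x : A.domain, (x : E) - (lam : 𝕜) • A x = y

/-- A `C₀`-semigroup of bounded linear operators on `E`. -/
structure C0Semigroup (𝕜 : Type*) [RCLike 𝕜] (E : Type*) [NormedAddCommGroup E]
    [NormedSpace 𝕜 E] where
  S : ℝ≥0 → E →L[𝕜] E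
  S_zero : S 0 = ContinuousLinearMap.id 𝕜 E
  S_add : ∀ s t, S (s + t) = (S s).comp (S t)
  tendsto_zero : ∀ x, Tendsto (fun t => S t x) (𝓝 0) (𝓝 x)

/-- `A` is the infinitesimal generator of `T`: `x ∈ D(A)` and `A x = y` if and only if
`(T(t) x - x) / t → y` as `t ↓ 0`. -/
def C0Semigroup.IsGenerator [NormedSpace 𝕜 E] (T : C0Semigroup 𝕜 E) (A : E →ₗ.[𝕜] E) : Prop :=
  ∀ x y : E, (x, y) ∈ A.graph ↔
    Tendsto (fun t : ℝ≥0 => ((t : ℝ) : 𝕜)⁻¹ • (T.S t x - x)) (𝓝[>] 0) (𝓝 y)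

variable [NormedSpace 𝕜 E] [NormedSpace ℝ E]

/-- `ξ` is a mild solution on `[0, ∞)` of `ξ' = A ξ`, `ξ(0) = x₀`: it is continuous and, for all
`t ≥ 0`, `∫₀ᵗ ξ(s) ds ∈ D(A)` and `ξ(t) = x₀ + A ∫₀ᵗ ξ(s) ds`. -/
def IsMildSolution (A : E →ₗ.[𝕜] E) (x₀ : E) (ξ : ℝ → E) : Prop :=
  ContinuousOn ξ (Ici 0) ∧ ∀ t ≥ 0, (∫ s in (0 : ℝ)..t, ξ s, ξ t - x₀) ∈ A.graph

/-- `ξ` is a classical solution on `[0, ∞)` of `ξ' = A ξ`, `ξ(0) = x₀`: it is continuously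
differentiable, `ξ(t) ∈ D(A)` and `ξ'(t) = A ξ(t)` for all `t ≥ 0`. -/
def IsClassicalSolution (A : E →ₗ.[𝕜] E) (x₀ : E) (ξ : ℝ → E) : Prop :=
  ξ 0 = x₀ ∧ ∃ ξ' : ℝ → E, ContinuousOn ξ' (Ici 0) ∧
    ∀ t ≥ 0, HasDerivWithinAt ξ (ξ' t) (Ici 0) t ∧ (ξ t, ξ' t) ∈ A.graph

/-- The Cauchy problem `ξ' = A ξ`, `ξ(0) = x₀` is well-posed: for every `x₀ ∈ E` it has one and
only one mild solution, which is a classical solution if `x₀ ∈ D(A)`, and solutions depend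
continuously on the initial value, uniformly on bounded time intervals. -/
structure IsWellPosed (A : E →ₗ.[𝕜] E) : Prop where
  exists_mild : ∀ x₀, ∃ ξ, IsMildSolution A x₀ ξ
  unique : ∀ x₀ ξ η, IsMildSolution A x₀ ξ → IsMildSolution A x₀ η → EqOn ξ η (Ici 0)
  classical : ∀ x₀ ∈ A.domain, ∀ ξ, IsMildSolution A x₀ ξ → IsClassicalSolution A x₀ ξ
  continuous_dependence : ∀ τ ≥ 0, ∃ C : ℝ, ∀ x₀ y₀ ξ η,
    IsMildSolution A x₀ ξ → IsMildSolution A y₀ η →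
      ∀ t ∈ Icc 0 τ, ‖ξ t - η t‖ ≤ C * ‖x₀ - y₀‖

end Semigroup

end ShakerBeam

end

/-!
Everything follows from two properties of the closed-loop operator `Ã`: it is dissipative and it is
maximal.

A maximal dissipative operator `A` on a Hilbert space is densely defined, since a vector orthogonal
to its domain has the form `x - lam A x`, and closed, since it has bounded resolvents. It generates
a contraction semigroup (Lumer–Phillips): the Yosida approximations `(R n - 1) / μ n`, with
`R n = (1 - μ n A)⁻¹` and `μ n → 0`, are bounded, dissipative and commute with each other, so that
their exponentials converge (`IsDissipative.exists_semigroup`). As `A` is closed, the orbits of the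
limit are mild solutions. Uniqueness is the energy estimate for the primitive `w` of a mild solution
with initial value `0`, which satisfies `w' = A w`; continuous dependence follows from uniqueness
and contractivity (`IsDissipative.exists_isGenerator_and_isWellPosed`).

For the beam, one identity carries both properties: integrating by parts twice on each side of `l₀`
gives the weak form of `η = Ã ξ` tested with an arbitrary state `ζ` (`Feedback.weak_form`). With
`ζ = η`, whose positions are the velocities of `ξ`, the elastic and inertial terms cancel in real
part and the damping remains: `Ã` is dissipative. With `ζ = ξ` it bounds `‖ξ‖` by a multiple
of `‖Ã ξ‖`. Moreover `Ã` is surjective (`Feedback.exists_mem_graph_closedLoop`): the equation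
`Ã ξ = η` is solved by integrating four times, up to the unknown jump of `u'''` at `l₀`, for which
the equation of the shaker is a scalar linear equation. It is solvable since a unit jump deflects
the beam at `l₀` by a nonpositive amount (`Feedback.p_eq_of_d2u_eq_tent`). A surjective operator
that is bounded below stays surjective under small perturbations, which gives the range of
`1 - lam Ã` for large `lam`.
-/

noncomputable section

namespace ShakerBeam

/-! ### Bounded dissipative operators -/

section Exponential

variable {𝕜 : Type*} [RCLike 𝕜] {E : Type*} [NormedAddCommGroup E] [NormedSpace 𝕜 E]

theorem commute_exp_ofReal_smul {B C : E →L[𝕜] E} (h : Commute B C) (t : ℝ) :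
    Commute B (NormedSpace.exp ((t : 𝕜) • C)) :=
  (h.smul_right (t : 𝕜)).exp_right

variable [CompleteSpace E]

theorem exp_ofReal_add_smul (B : E →L[𝕜] E) (s t : ℝ) (x : E) :
    NormedSpace.exp (((s + t : ℝ) : 𝕜) • B) x
      = NormedSpace.exp ((s : 𝕜) • B) (NormedSpace.exp ((t : 𝕜) • B) x) := by
  let _ : NormedAlgebra ℚ (E →L[𝕜] E) := NormedAlgebra.restrictScalars ℚ 𝕜 _
  rw [RCLike.ofReal_add, add_smul, NormedSpace.exp_add_of_commute
    (((Commute.refl B).smul_left _).smul_right _)]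
  rfl

theorem exp_sub_mul_exp {B C : E →L[𝕜] E} (hBC : Commute B C) (s t : ℝ) (x : E) :
    NormedSpace.exp ((s : 𝕜) • (B - C)) (NormedSpace.exp ((t : 𝕜) • C) x)
      = NormedSpace.exp ((s : 𝕜) • B) (NormedSpace.exp (((t - s : ℝ) : 𝕜) • C) x) := by
  let _ : NormedAlgebra ℚ (E →L[𝕜] E) := NormedAlgebra.restrictScalars ℚ 𝕜 _
  have h1 : Commute ((s : 𝕜) • (B - C)) ((t : 𝕜) • C) :=
    ((hBC.sub_left (Commute.refl C)).smul_left _).smul_right _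
  have h2 : Commute ((s : 𝕜) • B) (((t - s : ℝ) : 𝕜) • C) := (hBC.smul_left _).smul_right _
  rw [← mul_apply_eq_comp, ← mul_apply_eq_comp, ← NormedSpace.exp_add_of_commute h1,
    ← NormedSpace.exp_add_of_commute h2]
  congr 2
  push_cast
  module

variable [NormedSpace ℝ E] [IsScalarTower ℝ 𝕜 E]

theorem hasDerivAt_exp_ofReal_smul (B : E →L[𝕜] E) (x : E) (t : ℝ) :
    HasDerivAt (fun s : ℝ => NormedSpace.exp ((s : 𝕜) • B) x)
      (NormedSpace.exp ((t : 𝕜) • B) (B x)) t := by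
  have h1 : HasDerivAt (fun u : 𝕜 => NormedSpace.exp (u • B) x)
      (NormedSpace.exp ((t : 𝕜) • B) (B x)) (t : 𝕜) := by
    simpa using (hasDerivAt_exp_smul_const B (t : 𝕜)).clm_apply (hasDerivAt_const (t : 𝕜) x)
  have h2 : HasDerivAt (fun s : ℝ => (s : 𝕜)) 1 t := by
    simpa using (RCLike.ofRealCLM (K := 𝕜)).hasDerivAt (x := t)
  simpa [Function.comp_def] using HasDerivAt.scomp t h1 h2

theorem continuous_exp_ofReal_smul (B : E →L[𝕜] E) (x : E) :
    Continuous fun s : ℝ => NormedSpace.exp ((s : 𝕜) • B) x :=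
  continuous_iff_continuousAt.2 fun t => (hasDerivAt_exp_ofReal_smul B x t).continuousAt

end Exponential

section Bounded

variable {𝕜 : Type*} [RCLike 𝕜] {E : Type*} [NormedAddCommGroup E] [InnerProductSpace 𝕜 E]
  [NormedSpace ℝ E]

/-- The energy estimate: `‖f‖²` does not increase as long as `Re ⟨f', f⟩ ≤ 0`. -/
theorem norm_le_of_re_inner_deriv_nonpos {f f' : ℝ → E} (hc : ContinuousOn f (Ici 0))
    (hf : ∀ t > 0, HasDerivAt f (f' t) t)
    (h : ∀ t > 0, RCLike.re (inner 𝕜 (f' t) (f t)) ≤ 0) {t : ℝ} (ht : 0 ≤ t) :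
    ‖f t‖ ≤ ‖f 0‖ := by
  have hd : ∀ s > 0, HasDerivAt (fun s => RCLike.re (inner 𝕜 (f s) (f s)))
      (RCLike.re (inner 𝕜 (f s) (f' s) + inner 𝕜 (f' s) (f s))) s := fun s hs =>
    (RCLike.reCLM (K := 𝕜)).hasFDerivAt.comp_hasDerivAt s ((hf s hs).inner 𝕜 (hf s hs))
  have hanti : AntitoneOn (fun s => RCLike.re (inner 𝕜 (f s) (f s))) (Ici 0) := by
    refine antitoneOn_of_deriv_nonpos (convex_Ici 0) ?_ ?_ ?_
    · exact RCLike.continuous_re.comp_continuousOn (ContinuousOn.inner (𝕜 := 𝕜) hc hc)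
    · intro s hs
      rw [interior_Ici] at hs
      exact (hd s hs).differentiableAt.differentiableWithinAt
    · intro s hs
      rw [interior_Ici] at hs
      rw [(hd s hs).deriv, map_add, inner_re_symm]
      linarith [h s hs]
  have := hanti (mem_Ici.2 le_rfl) (mem_Ici.2 ht) ht
  simp only [inner_self_eq_norm_sq] at this
  exact le_of_sq_le_sq this (norm_nonneg _)

variable [IsScalarTower ℝ 𝕜 E] [CompleteSpace E]

/-- The operators `e^{t B}`, `t ≥ 0`, are contractions if the bounded operator `B` is dissipative. -/
theorem norm_exp_ofReal_smul_le {B : E →L[𝕜] E}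
    (hB : ∀ x, RCLike.re (inner 𝕜 (B x) x) ≤ 0) {t : ℝ} (ht : 0 ≤ t) (x : E) :
    ‖NormedSpace.exp ((t : 𝕜) • B) x‖ ≤ ‖x‖ := by
  have := norm_le_of_re_inner_deriv_nonpos (𝕜 := 𝕜) (continuous_exp_ofReal_smul B x).continuousOn
    (fun s _ => hasDerivAt_exp_ofReal_smul B x s) (fun s _ => ?_) ht
  · simpa using this
  · have := congr($((commute_exp_ofReal_smul (Commute.refl B) s).eq) x)
    simp only [mul_apply_eq_comp] at this
    rw [← this]
    exact hB _

/-- Commuting contraction semigroups are compared along `s ↦ e^{s (B - C)} e^{t C} x`, whose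
derivative is `e^{s B} e^{(t - s) C} (B - C) x`. -/
theorem norm_exp_sub_exp_le {B C : E →L[𝕜] E} (hBC : Commute B C)
    (hB : ∀ x, RCLike.re (inner 𝕜 (B x) x) ≤ 0) (hC : ∀ x, RCLike.re (inner 𝕜 (C x) x) ≤ 0)
    {t : ℝ} (ht : 0 ≤ t) (x : E) :
    ‖NormedSpace.exp ((t : 𝕜) • B) x - NormedSpace.exp ((t : 𝕜) • C) x‖ ≤ ‖B x - C x‖ * t := by
  have hd := fun s : ℝ => hasDerivAt_exp_ofReal_smul (B - C) (NormedSpace.exp ((t : 𝕜) • C) x) s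
  have := norm_image_sub_le_of_norm_deriv_le_segment' (a := 0) (b := t)
    (C := ‖B x - C x‖) (fun s _ => (hd s).hasDerivWithinAt) (fun s hs => ?_) t (right_mem_Icc.2 ht)
  · rw [exp_sub_mul_exp hBC] at this
    simpa using this
  · have hcomm := congr($((commute_exp_ofReal_smul
      (hBC.sub_left (Commute.refl C)) t).eq) x)
    simp only [mul_apply_eq_comp] at hcomm
    rw [hcomm, exp_sub_mul_exp hBC]
    exact (norm_exp_ofReal_smul_le hB hs.1 _).trans
      (norm_exp_ofReal_smul_le hC (sub_nonneg.2 hs.2.le) _)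

end Bounded

/-! ### Resolvents of maximal dissipative operators -/

section Resolvent

/-- Suppose that `H x y` has a solution `x` for every `y`, and that `x` depends on `y` in a Lipschitz
way with constant `C`. Then `H x (y + c x)` has a solution `x` for every `y` if `C |c| < 1`, by the
contraction principle. -/
theorem exists_perturbed_preimage {𝕜 E : Type*} [RCLike 𝕜] [NormedAddCommGroup E]
    [NormedSpace 𝕜 E] [CompleteSpace E]
    {H : E → E → Prop} (hsurj : ∀ y, ∃ x, H x y) {C : ℝ} (hC : 0 ≤ C)
    (hbd : ∀ x y x' y', H x y → H x' y' → ‖x - x'‖ ≤ C * ‖y - y'‖) {c : 𝕜} (hc : C * ‖c‖ < 1)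
    (y : E) : ∃ x, H x (y + c • x) := by
  choose R hR using hsurj
  have hcon : ContractingWith (NNReal.mk (C * ‖c‖) (by positivity)) fun x => R (y + c • x) := by
    refine ⟨by exact_mod_cast hc, LipschitzWith.of_dist_le_mul fun x x' => ?_⟩
    rw [dist_eq_norm, dist_eq_norm]
    refine (hbd _ _ _ _ (hR _) (hR _)).trans_eq ?_
    rw [add_sub_add_left_eq_sub, ← smul_sub, norm_smul, NNReal.coe_mk, mul_assoc]
  refine ⟨ContractingWith.fixedPoint _ hcon, ?_⟩
  have h := hcon.fixedPoint_isFixedPt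
  nth_rewrite 1 [← h.eq]
  exact hR _

variable {𝕜 : Type*} [RCLike 𝕜] {E : Type*} [NormedAddCommGroup E] [InnerProductSpace 𝕜 E]
  {A : E →ₗ.[𝕜] E}

theorem IsDissipative.re_inner_le (hA : IsDissipative A) {x y : E} (h : (x, y) ∈ A.graph) :
    RCLike.re (inner 𝕜 y x) ≤ 0 := by
  rw [LinearPMap.mem_graph_iff] at h
  obtain ⟨z, rfl, rfl⟩ := h
  exact hA z

theorem IsDissipative.norm_le (hA : IsDissipative A) {μ : ℝ} (hμ : 0 < μ) {x y : E}
    (h : (x, y) ∈ A.graph) : ‖x‖ ≤ ‖x - (μ : 𝕜) • y‖ := by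
  have h1 := hA.re_inner_le h
  have h2 : ‖x‖ ^ 2 ≤ RCLike.re (inner 𝕜 (x - (μ : 𝕜) • y) x) := by
    rw [inner_sub_left, inner_smul_left, map_sub, RCLike.conj_ofReal, RCLike.re_ofReal_mul,
      inner_self_eq_norm_sq]
    nlinarith
  have h3 := (RCLike.re_le_norm _).trans (norm_inner_le_norm (𝕜 := 𝕜) (x - (μ : 𝕜) • y) x)
  rcases (norm_nonneg x).eq_or_lt with h0 | h0
  · rw [← h0]; exact norm_nonneg _
  · nlinarith

/-- In a maximal dissipative operator the range condition holds for every `μ > 0`, as it passes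
from `lam` to all `μ > lam / 2`. -/
theorem IsDissipative.exists_mem_graph [CompleteSpace E] (hA : IsDissipative A)
    (hM : IsMaximal A) {μ : ℝ} (hμ : 0 < μ) (y : E) :
    ∃ z : E × E, (z.1, z.2) ∈ A.graph ∧ z.1 - (μ : 𝕜) • z.2 = y := by
  have step : ∀ lam ν : ℝ, 0 < lam → lam < 2 * ν →
      (∀ y, ∃ z : E × E, (z.1, z.2) ∈ A.graph ∧ z.1 - (lam : 𝕜) • z.2 = y) →
      ∀ y, ∃ z : E × E, (z.1, z.2) ∈ A.graph ∧ z.1 - (ν : 𝕜) • z.2 = y := by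
    intro lam ν hl hlν hs y
    have hν : 0 < ν := by linarith
    have hν' : (ν : 𝕜) ≠ 0 := by exact_mod_cast hν.ne'
    have hl' : (lam : 𝕜) ≠ 0 := by exact_mod_cast hl.ne'
    obtain ⟨x, w, hw, hx⟩ := exists_perturbed_preimage
      (H := fun x y => ∃ w, (x, w) ∈ A.graph ∧ x - (lam : 𝕜) • w = y) (C := 1)
      (c := ((1 - lam / ν : ℝ) : 𝕜))
      (fun y => by obtain ⟨z, hz, h⟩ := hs y; exact ⟨z.1, z.2, hz, h⟩) zero_le_one
      (by
        rintro x y x' y' ⟨w, hw, rfl⟩ ⟨w', hw', rfl⟩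
        rw [one_mul]
        refine (hA.norm_le hl (A.graph.sub_mem hw hw')).trans_eq ?_
        congr 1
        module)
      (by
        rw [one_mul, RCLike.norm_ofReal, abs_lt]
        have : lam / ν < 2 := by rwa [div_lt_iff₀ hν]
        have : 0 < lam / ν := by positivity
        constructor <;> linarith) (((lam / ν : ℝ) : 𝕜) • y)
    refine ⟨(x, w), hw, ?_⟩
    have h1 : ((lam / ν : ℝ) : 𝕜) • x = ((lam / ν : ℝ) : 𝕜) • y + (lam : 𝕜) • w := by
      have h2 : x = ((lam / ν : ℝ) : 𝕜) • y + ((1 - lam / ν : ℝ) : 𝕜) • x + (lam : 𝕜) • w :=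
        sub_eq_iff_eq_add.1 hx
      push_cast at h2 ⊢
      rw [sub_smul, one_smul] at h2
      have h3 := congr($h2 - x + ((lam : 𝕜) / ν) • x)
      rw [sub_self, zero_add] at h3
      rw [h3]
      abel
    have h4 := congr(((ν / lam : ℝ) : 𝕜) • $h1)
    rw [smul_add, smul_smul, smul_smul, smul_smul, ← RCLike.ofReal_mul, ← RCLike.ofReal_mul,
      show ν / lam * (lam / ν) = 1 by field_simp, show ν / lam * lam = ν by field_simp] at h4
    simp only [RCLike.ofReal_one, one_smul] at h4
    rw [sub_eq_iff_eq_add]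
    exact h4
  obtain ⟨lam, hlam, hs⟩ := hM
  have hn : ∀ n : ℕ, ∀ y, ∃ z : E × E, (z.1, z.2) ∈ A.graph ∧
      z.1 - ((lam * (2 / 3) ^ n : ℝ) : 𝕜) • z.2 = y := by
    intro n
    induction n with
    | zero =>
      intro y
      obtain ⟨x, hx⟩ := hs y
      exact ⟨(x, A x), A.mem_graph x, by simpa using hx⟩
    | succ n ih =>
      have : 0 < lam * (2 / 3 : ℝ) ^ n := by positivity
      exact step _ _ this (by rw [pow_succ]; linarith) ih
  obtain ⟨n, hn'⟩ := exists_pow_lt_of_lt_one (show 0 < μ / lam by positivity)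
    (show (2 / 3 : ℝ) < 1 by norm_num)
  rw [lt_div_iff₀ hlam] at hn'
  exact step _ _ (by positivity) (by linarith) (hn n) y

/-- `R` is the resolvent `(1 - μ A)⁻¹`, and a contraction. -/
structure IsResolvent (A : E →ₗ.[𝕜] E) (μ : ℝ) (R : E →L[𝕜] E) : Prop where
  norm_le : ∀ y, ‖R y‖ ≤ ‖y‖
  mem_graph : ∀ y, (R y, (μ : 𝕜)⁻¹ • (R y - y)) ∈ A.graph
  apply_sub : ∀ x y, (x, y) ∈ A.graph → R (x - (μ : 𝕜) • y) = x

theorem IsDissipative.exists_isResolvent [CompleteSpace E] (hA : IsDissipative A)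
    (hM : IsMaximal A) {μ : ℝ} (hμ : 0 < μ) : ∃ R, IsResolvent A μ R := by
  have hμ' : (μ : 𝕜) ≠ 0 := by exact_mod_cast hμ.ne'
  choose z hz hy using hA.exists_mem_graph hM hμ
  have huniq : ∀ x w, (x, w) ∈ A.graph → (z (x - (μ : 𝕜) • w)).1 = x := by
    intro x w hxw
    rw [← sub_eq_zero, ← norm_le_zero_iff]
    refine (hA.norm_le hμ (A.graph.sub_mem (hz (x - (μ : 𝕜) • w)) hxw)).trans_eq ?_
    rw [norm_eq_zero]
    have := hy (x - (μ : 𝕜) • w)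
    rw [smul_sub, sub_sub_sub_comm, this, sub_self]
  refine ⟨LinearMap.mkContinuous
    { toFun := fun y => (z y).1
      map_add' := fun y y' => ?_
      map_smul' := fun c y => ?_ } 1 fun y => ?_, ?_, ?_, ?_⟩
  · have := huniq _ _ (A.graph.add_mem (hz y) (hz y'))
    rwa [smul_add, add_sub_add_comm, hy, hy] at this
  · have := huniq _ _ (A.graph.smul_mem c (hz y))
    rwa [smul_comm, ← smul_sub, hy] at this
  · rw [one_mul]
    refine (hA.norm_le hμ (hz y)).trans_eq ?_
    rw [hy]
  · intro y
    refine (hA.norm_le hμ (hz y)).trans_eq ?_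
    rw [hy]
  · intro y
    have : (μ : 𝕜)⁻¹ • ((z y).1 - y) = (z y).2 := by
      nth_rewrite 2 [← hy y]
      rw [sub_sub_cancel, inv_smul_smul₀ hμ']
    simp only [LinearMap.mkContinuous_apply, LinearMap.coe_mk, AddHom.coe_mk]
    rw [this]
    exact hz y
  · exact huniq

namespace IsResolvent

variable {μ ν : ℝ} {R Q : E →L[𝕜] E}

theorem isClosed (hR : IsResolvent A μ R) (hμ : 0 < μ) : A.IsClosed := by
  have hμ' : (μ : 𝕜) ≠ 0 := by exact_mod_cast hμ.ne'
  have : (A.graph : Set (E × E)) = {z | R (z.1 - (μ : 𝕜) • z.2) = z.1} := by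
    ext z
    refine ⟨hR.apply_sub z.1 z.2, fun h => ?_⟩
    have := hR.mem_graph (z.1 - (μ : 𝕜) • z.2)
    rw [mem_ofPred_eq] at h
    rwa [h, sub_sub_cancel, inv_smul_smul₀ hμ'] at this
  rw [LinearPMap.IsClosed, this]
  exact isClosed_eq (by fun_prop) (by fun_prop)

theorem commute (hR : IsResolvent A μ R) (hQ : IsResolvent A ν Q) (hμ : 0 < μ) (hν : 0 < ν) :
    Commute R Q := by
  have hμ' : (μ : 𝕜) ≠ 0 := by exact_mod_cast hμ.ne'
  have hν' : (ν : 𝕜) ≠ 0 := by exact_mod_cast hν.ne'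
  ext y
  -- `x = R (Q y)` and its image `A x` lie in the domain, so `1 - ν A` can be applied to `x`.
  have h1 := hR.mem_graph (Q y)
  have h2 := hQ.mem_graph y
  have h3 : ((μ : 𝕜)⁻¹ • (R (Q y) - Q y), (μ : 𝕜)⁻¹ • ((μ : 𝕜)⁻¹ • (R (Q y) - Q y)
      - (ν : 𝕜)⁻¹ • (Q y - y))) ∈ A.graph := A.graph.smul_mem (μ : 𝕜)⁻¹ (A.graph.sub_mem h1 h2)
  have h4 := hR.apply_sub _ _ (A.graph.sub_mem h1 (A.graph.smul_mem (ν : 𝕜) h3))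
  have h5 := hQ.apply_sub _ _ h1
  simp only [mul_apply_eq_comp]
  rw [← h5]
  simp only [Prod.smul_fst, Prod.smul_snd] at h4
  rw [← h4]
  congr 2
  match_scalars <;> field_simp <;> ring

theorem apply_sub_self (hR : IsResolvent A μ R) {x y : E} (h : (x, y) ∈ A.graph) :
    R x - x = (μ : 𝕜) • R y := by
  have := hR.apply_sub x y h
  rw [map_sub, map_smul] at this
  nth_rewrite 2 [← this]
  rw [sub_sub_cancel]

theorem re_inner_sub_le (hR : IsResolvent A μ R) (x : E) :
    RCLike.re (inner 𝕜 (R x - x) x) ≤ 0 := by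
  rw [inner_sub_left, map_sub, inner_self_eq_norm_sq]
  have h := (RCLike.re_le_norm _).trans (norm_inner_le_norm (𝕜 := 𝕜) (R x) x)
  nlinarith [hR.norm_le x, norm_nonneg x]

end IsResolvent

/-- A vector orthogonal to the domain is `x - lam A x` for some `x`, hence `x = 0` by
dissipativity. -/
theorem IsDissipative.dense_domain [CompleteSpace E] (hA : IsDissipative A)
    (hM : IsMaximal A) : Dense (A.domain : Set E) := by
  rw [Submodule.dense_iff_topologicalClosure_eq_top, Submodule.topologicalClosure_eq_top_iff,
    Submodule.eq_bot_iff]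
  intro y hy
  obtain ⟨lam, hlam, hs⟩ := hM
  obtain ⟨x, rfl⟩ := hs y
  have h1 := (Submodule.mem_orthogonal' _ _).1 hy x x.2
  have h2 := congrArg RCLike.re h1
  rw [inner_sub_left, inner_smul_left, map_sub, RCLike.conj_ofReal, RCLike.re_ofReal_mul,
    inner_self_eq_norm_sq, map_zero] at h2
  have h3 : ‖(x : E)‖ ^ 2 ≤ 0 := by nlinarith [hA x]
  have h4 : x = 0 := by
    ext
    exact norm_eq_zero.1 (pow_eq_zero_iff two_ne_zero |>.1 (le_antisymm h3 (sq_nonneg _)))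
  simp [h4]

end Resolvent

/-! ### Generation of the semigroup -/

section Generation

section Contractions

variable {𝕜 : Type*} [RCLike 𝕜] {E : Type*} [NormedAddCommGroup E] [NormedSpace 𝕜 E]

theorem tendsto_contraction_apply {ι : Type*} {f : Filter ι} {T : ι → E →L[𝕜] E} {z : ι → E}
    {x y : E} (hT : ∀ i x, ‖T i x‖ ≤ ‖x‖) (hx : Tendsto (fun i => T i x) f (𝓝 y))
    (hz : Tendsto z f (𝓝 x)) : Tendsto (fun i => T i (z i)) f (𝓝 y) := by
  have h : Tendsto (fun i => T i (z i - x)) f (𝓝 0) :=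
    squeeze_zero_norm (fun i => hT i _) (tendsto_iff_norm_sub_tendsto_zero.1 hz)
  simpa using h.add hx

/-- Pointwise convergence of contractions to a contraction need only be checked on a dense set. -/
theorem tendsto_contraction_of_dense {ι : Type*} {f : Filter ι} {T : ι → E →L[𝕜] E}
    {S : E →L[𝕜] E} (hT : ∀ i x, ‖T i x‖ ≤ ‖x‖) (hS : ∀ x, ‖S x‖ ≤ ‖x‖) {D : Set E}
    (hD : Dense D) (h : ∀ x ∈ D, Tendsto (fun i => T i x) f (𝓝 (S x))) (x : E) :
    Tendsto (fun i => T i x) f (𝓝 (S x)) := by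
  rw [Metric.tendsto_nhds]
  intro ε hε
  obtain ⟨y, hy, hxy⟩ := hD.exists_dist_lt x (show 0 < ε / 3 by positivity)
  filter_upwards [Metric.tendsto_nhds.1 (h y hy) (ε / 3) (by positivity)] with i hi
  have h1 := hT i (x - y)
  have h2 := hS (y - x)
  rw [map_sub, ← dist_eq_norm, ← dist_eq_norm] at h1 h2
  rw [dist_comm y x] at h2
  linarith [dist_triangle4 (T i x) (T i y) (S y) (S x)]

/-- A pointwise limit of contractions exists as soon as the sequence is Cauchy on a dense set. -/
theorem exists_limit_of_contractions [CompleteSpace E] {T : ℕ → E →L[𝕜] E}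
    (hT : ∀ n x, ‖T n x‖ ≤ ‖x‖) {D : Set E} (hD : Dense D)
    (h : ∀ x ∈ D, CauchySeq fun n => T n x) :
    ∃ S : E →L[𝕜] E, ∀ x, Tendsto (fun n => T n x) atTop (𝓝 (S x)) := by
  have hc : ∀ x, ∃ y, Tendsto (fun n => T n x) atTop (𝓝 y) := fun x => by
    refine cauchySeq_tendsto_of_complete (Metric.cauchySeq_iff.2 fun ε hε => ?_)
    obtain ⟨y, hy, hxy⟩ := hD.exists_dist_lt x (show 0 < ε / 3 by positivity)
    obtain ⟨N, hN⟩ := Metric.cauchySeq_iff.1 (h y hy) (ε / 3) (by positivity)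
    refine ⟨N, fun m hm n hn => ?_⟩
    have h1 := hT m (x - y)
    have h2 := hT n (y - x)
    rw [map_sub, ← dist_eq_norm, ← dist_eq_norm] at h1 h2
    rw [dist_comm y x] at h2
    linarith [dist_triangle4 (T m x) (T m y) (T n y) (T n x), hN m hm n hn]
  choose S hS using hc
  refine ⟨(linearMapOfTendsto S (fun n => (T n : E →ₗ[𝕜] E))
    (tendsto_pi_nhds.2 hS)).mkContinuous 1 fun x => ?_, hS⟩
  rw [one_mul]
  exact le_of_tendsto (hS x).norm (Eventually.of_forall fun n => hT n x)

theorem C0Semigroup.continuous_apply (T : C0Semigroup 𝕜 E) (hT : ∀ t x, ‖T.S t x‖ ≤ ‖x‖) (x : E) :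
    Continuous fun t => T.S t x := by
  have key : ∀ s t, s ≤ t → dist (T.S s x) (T.S t x) ≤ dist (T.S (t - s) x) x := by
    intro s t hst
    have h : T.S t x = T.S s (T.S (t - s) x) := by
      rw [← ContinuousLinearMap.comp_apply, ← T.S_add, add_tsub_cancel_of_le hst]
    rw [h, dist_comm, dist_eq_norm, dist_eq_norm, ← map_sub]
    exact hT _ _
  have hsym : ∀ s t, dist (T.S s x) (T.S t x) ≤ dist (T.S ((t - s) + (s - t)) x) x := by
    intro s t
    rcases le_total s t with h | h
    · simpa [tsub_eq_zero_of_le h] using key s t h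
    · rw [dist_comm]
      simpa [tsub_eq_zero_of_le h] using key t s h
  rw [continuous_iff_continuousAt]
  intro t
  rw [ContinuousAt, tendsto_iff_dist_tendsto_zero]
  refine squeeze_zero (fun _ => dist_nonneg) (fun s => hsym s t) ?_
  rw [← tendsto_iff_dist_tendsto_zero]
  refine (T.tendsto_zero x).comp ?_
  have : Continuous fun s : ℝ≥0 => (t - s) + (s - t) := by fun_prop
  simpa using this.tendsto t

end Contractions

variable {𝕜 : Type*} [RCLike 𝕜] {E : Type*} [NormedAddCommGroup E] [InnerProductSpace 𝕜 E]
  [NormedSpace ℝ E] [CompleteSpace E] {A : E →ₗ.[𝕜] E}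

theorem IsDissipative.intervalIntegral_mem_graph (hA : IsDissipative A) (hM : IsMaximal A)
    {f g : ℝ → E} (hf : Continuous f) (hg : Continuous g) (h : ∀ s, (f s, g s) ∈ A.graph)
    (a b : ℝ) : (∫ s in a..b, f s, ∫ s in a..b, g s) ∈ A.graph := by
  obtain ⟨R, hR⟩ := hA.exists_isResolvent hM one_pos
  have h1 : R (∫ s in a..b, (f s - g s)) = ∫ s in a..b, f s := by
    rw [← R.intervalIntegral_comp_comm (show IntervalIntegrable (fun s => f s - g s)
      volume a b from (hf.sub hg).intervalIntegrable _ _)]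
    refine intervalIntegral.integral_congr fun s _ => ?_
    simpa using hR.apply_sub _ _ (h s)
  have h2 := hR.mem_graph (∫ s in a..b, (f s - g s))
  rw [h1, intervalIntegral.integral_sub (hf.intervalIntegrable _ _)
    (hg.intervalIntegrable _ _), sub_sub_cancel] at h2
  simpa using h2

variable [IsScalarTower ℝ 𝕜 E]

/-- A maximal dissipative operator generates a contraction semigroup: the semigroups of its Yosida
approximations `(R n - 1) / μ n`, where `R n = (1 - μ n A)⁻¹` and `μ n → 0`, converge. The second
property says that orbits are mild solutions, the third that the semigroup commutes with `A`. -/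
theorem IsDissipative.exists_semigroup (hA : IsDissipative A) (hM : IsMaximal A) :
    ∃ T : C0Semigroup 𝕜 E, (∀ t x, ‖T.S t x‖ ≤ ‖x‖) ∧
      (∀ x, ∀ t ≥ 0, (∫ s in (0 : ℝ)..t, T.S s.toNNReal x, T.S t.toNNReal x - x) ∈ A.graph) ∧
      ∀ x y, (x, y) ∈ A.graph → ∀ t, (T.S t x, T.S t y) ∈ A.graph := by
  set μ : ℕ → ℝ := fun n => 1 / ((n : ℝ) + 1) with hμ
  have hμ0 : ∀ n, 0 < μ n := fun n => by positivity
  have hμlim : Tendsto μ atTop (𝓝 0) := tendsto_one_div_add_atTop_nhds_zero_nat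
  choose R hR using fun n => hA.exists_isResolvent hM (hμ0 n)
  have hclosed := (hR 0).isClosed (hμ0 0)
  have hD := hA.dense_domain hM
  have hRlim : ∀ x, Tendsto (fun n => R n x) atTop (𝓝 x) := by
    refine tendsto_contraction_of_dense (S := ContinuousLinearMap.id 𝕜 E)
      (fun n => (hR n).norm_le) (fun x => le_rfl) hD fun x hx => ?_
    obtain ⟨y, hy⟩ := LinearPMap.mem_domain_iff.1 hx
    rw [tendsto_iff_norm_sub_tendsto_zero]
    refine squeeze_zero (g := fun n => μ n * ‖y‖) (fun _ => norm_nonneg _) (fun n => ?_) ?_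
    · rw [ContinuousLinearMap.id_apply, (hR n).apply_sub_self hy, norm_smul, RCLike.norm_ofReal,
        abs_of_pos (hμ0 n)]
      exact mul_le_mul_of_nonneg_left ((hR n).norm_le y) (hμ0 n).le
    · simpa using hμlim.mul_const ‖y‖
  set Y : ℕ → E →L[𝕜] E := fun n => (μ n : 𝕜)⁻¹ • (R n - 1) with hY
  have hYapply : ∀ n x, Y n x = (μ n : 𝕜)⁻¹ • (R n x - x) := fun n x => rfl
  have hYdiss : ∀ n x, RCLike.re (inner 𝕜 (Y n x) x) ≤ 0 := fun n x => by
    rw [hYapply, inner_smul_left, map_inv₀, RCLike.conj_ofReal, ← RCLike.ofReal_inv,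
      RCLike.re_ofReal_mul]
    exact mul_nonpos_of_nonneg_of_nonpos (inv_nonneg.2 (hμ0 n).le) ((hR n).re_inner_sub_le x)
  have hYcomm : ∀ n m, Commute (Y n) (Y m) := fun n m =>
    (((((hR n).commute (hR m) (hμ0 n) (hμ0 m)).sub_left (Commute.one_left _)).sub_right
      (Commute.one_right _)).smul_left _).smul_right _
  have hYR : ∀ {x y}, (x, y) ∈ A.graph → ∀ n, Y n x = R n y := fun h n => by
    have hμ' : (μ n : 𝕜) ≠ 0 := by exact_mod_cast (hμ0 n).ne'
    rw [hYapply, (hR n).apply_sub_self h, inv_smul_smul₀ hμ']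
  set U : ℕ → ℝ≥0 → E →L[𝕜] E := fun n t => NormedSpace.exp (((t : ℝ) : 𝕜) • Y n) with hU
  have hUle : ∀ t n x, ‖U n t x‖ ≤ ‖x‖ := fun t n x => norm_exp_ofReal_smul_le (hYdiss n) t.2 x
  have hUlim : ∀ t, ∃ S : E →L[𝕜] E, ∀ x, Tendsto (fun n => U n t x) atTop (𝓝 (S x)) := by
    refine fun t => exists_limit_of_contractions (hUle t) hD fun x hx => ?_
    obtain ⟨y, hy⟩ := LinearPMap.mem_domain_iff.1 hx
    have hc : CauchySeq fun n => Y n x := by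
      simp only [hYR hy]
      exact (hRlim y).cauchySeq
    rw [Metric.cauchySeq_iff] at hc ⊢
    intro ε hε
    obtain ⟨N, hN⟩ := hc (ε / (t + 1)) (by positivity)
    refine ⟨N, fun m hm n hn => ?_⟩
    have h1 := norm_exp_sub_exp_le (hYcomm m n) (hYdiss m) (hYdiss n) t.2 x
    have h2 := hN m hm n hn
    rw [dist_eq_norm] at h2 ⊢
    rw [lt_div_iff₀ (by positivity)] at h2
    refine h1.trans_lt (lt_of_le_of_lt ?_ h2)
    exact mul_le_mul_of_nonneg_left (by simp) (norm_nonneg _)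
  choose S hS using hUlim
  have hSle : ∀ t x, ‖S t x‖ ≤ ‖x‖ := fun t x =>
    le_of_tendsto (hS t x).norm (Eventually.of_forall fun n => hUle t n x)
  have hUzero : ∀ n x, U n 0 x = x := fun n x => by simp [hU]
  -- On the domain the orbits are Lipschitz at `0`, by comparison with the zero generator.
  have hSlip : ∀ {x y}, (x, y) ∈ A.graph → ∀ t, ‖S t x - x‖ ≤ ‖y‖ * t := by
    intro x y h t
    refine le_of_tendsto ((hS t x).sub_const x).norm (Eventually.of_forall fun n => ?_)
    have h1 := norm_exp_sub_exp_le (Commute.zero_right (Y n)) (hYdiss n)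
      (C := 0) (by simp) t.2 x
    simp only [smul_zero, NormedSpace.exp_zero, one_apply_eq_self, zero_apply, sub_zero,
      hYR h] at h1
    exact h1.trans (mul_le_mul_of_nonneg_right ((hR n).norm_le y) t.2)
  let T : C0Semigroup 𝕜 E :=
    { S := S
      S_zero := by
        ext x
        refine tendsto_nhds_unique (hS 0 x) ?_
        simp [hUzero]
      S_add := fun s t => by
        ext x
        refine tendsto_nhds_unique (hS (s + t) x) ?_
        refine (tendsto_contraction_apply (hUle s) (hS s (S t x)) (hS t x)).congr fun n => ?_
        simp only [hU]
        rw [NNReal.coe_add, exp_ofReal_add_smul]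
      tendsto_zero := by
        refine tendsto_contraction_of_dense (S := ContinuousLinearMap.id 𝕜 E) hSle
          (fun x => le_rfl) hD fun x hx => ?_
        obtain ⟨y, hy⟩ := LinearPMap.mem_domain_iff.1 hx
        rw [tendsto_iff_norm_sub_tendsto_zero]
        refine squeeze_zero (fun _ => norm_nonneg _) (fun t => hSlip hy t) ?_
        have : Continuous fun t : ℝ≥0 => ‖y‖ * (t : ℝ) := by fun_prop
        simpa using this.tendsto 0 }
  refine ⟨T, hSle, fun x t ht => ?_, fun x y h t => ?_⟩
  · have hz : Tendsto (fun n => ∫ s in (0 : ℝ)..t, U n s.toNNReal x) atTop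
        (𝓝 (∫ s in (0 : ℝ)..t, T.S s.toNNReal x)) := by
      refine intervalIntegral.tendsto_integral_filter_of_dominated_convergence (fun _ => ‖x‖)
        (Eventually.of_forall fun n => ?_)
        (Eventually.of_forall fun n => Eventually.of_forall fun s _ => hUle _ n x)
        intervalIntegrable_const (Eventually.of_forall fun s _ => hS _ x)
      have h1 := (continuous_exp_ofReal_smul (Y n) x).comp
        (NNReal.continuous_coe.comp continuous_real_toNNReal)
      exact h1.aestronglyMeasurable
    have hYz : ∀ n, Y n (∫ s in (0 : ℝ)..t, U n s.toNNReal x) = U n t.toNNReal x - x := by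
      intro n
      have hcont := continuous_exp_ofReal_smul (Y n) x
      have h1 : ∫ s in (0 : ℝ)..t, U n s.toNNReal x
          = ∫ s in (0 : ℝ)..t, NormedSpace.exp ((s : 𝕜) • Y n) x := by
        refine intervalIntegral.integral_congr fun s hs => ?_
        rw [uIcc_of_le ht] at hs
        simp only [hU]
        rw [Real.coe_toNNReal _ hs.1]
      rw [h1, ← (Y n).intervalIntegral_comp_comm (hcont.intervalIntegrable _ _)]
      have h2 : ∀ s ∈ uIcc 0 t, HasDerivAt (fun s : ℝ => NormedSpace.exp ((s : 𝕜) • Y n) x)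
          (Y n (NormedSpace.exp ((s : 𝕜) • Y n) x)) s := fun s _ => by
        have := congr($((commute_exp_ofReal_smul (Commute.refl (Y n)) s).eq) x)
        simp only [mul_apply_eq_comp] at this
        rw [this]
        exact hasDerivAt_exp_ofReal_smul (Y n) x s
      rw [intervalIntegral.integral_eq_sub_of_hasDerivAt h2
        (((Y n).continuous.comp hcont).intervalIntegrable _ _)]
      simp only [hU]
      rw [Real.coe_toNNReal _ ht]
      simp
    have hmem : ∀ n, (R n (∫ s in (0 : ℝ)..t, U n s.toNNReal x), U n t.toNNReal x - x)
        ∈ A.graph := fun n => by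
      rw [← hYz, hYapply]
      exact (hR n).mem_graph _
    refine hclosed.mem_of_tendsto (Tendsto.prodMk_nhds ?_ ((hS _ x).sub_const x))
      (Eventually.of_forall hmem)
    exact tendsto_contraction_apply (fun n => (hR n).norm_le) (hRlim _) hz
  · -- The resolvent commutes with the approximating semigroups, hence with their limit.
    have hcomm : ∀ z, R 0 (S t z) = S t (R 0 z) := fun z => by
      refine tendsto_nhds_unique (((R 0).continuous.tendsto _).comp (hS t z))
        ((hS t (R 0 z)).congr fun n => ?_)
      have h1 : Commute (R 0) (Y n) :=
        (((hR 0).commute (hR n) (hμ0 0) (hμ0 n)).sub_right (Commute.one_right _)).smul_right _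
      exact congr($((commute_exp_ofReal_smul h1 t).eq) z).symm
    have hμ' : (μ 0 : 𝕜) ≠ 0 := by exact_mod_cast (hμ0 0).ne'
    have h1 := (hR 0).mem_graph (S t (x - (μ 0 : 𝕜) • y))
    rw [hcomm, (hR 0).apply_sub x y h, map_sub, sub_sub_cancel, map_smul,
      inv_smul_smul₀ hμ'] at h1
    exact h1

/-- The Lumer–Phillips theorem, together with well-posedness of the Cauchy problem. -/
theorem IsDissipative.exists_isGenerator_and_isWellPosed (hA : IsDissipative A)
    (hM : IsMaximal A) : (∃ T : C0Semigroup 𝕜 E, T.IsGenerator A) ∧ IsWellPosed A := by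
  obtain ⟨T, hT, hmild, hinv⟩ := hA.exists_semigroup hM
  have hcont : ∀ x, Continuous fun s : ℝ => T.S s.toNNReal x := fun x =>
    (T.continuous_apply hT x).comp continuous_real_toNNReal
  have hzero : ∀ x, T.S 0 x = x := fun x => by rw [T.S_zero]; rfl
  have hint : ∀ {x y}, (x, y) ∈ A.graph → ∀ t ≥ 0,
      T.S t.toNNReal x - x = ∫ s in (0 : ℝ)..t, T.S s.toNNReal y := fun h t ht =>
    A.mem_graph_snd_inj (hmild _ t ht) (hA.intervalIntegral_mem_graph hM (hcont _) (hcont _)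
      (fun s => hinv _ _ h s.toNNReal) 0 t) rfl
  have hderiv : ∀ {x y}, (x, y) ∈ A.graph → ∀ t ≥ 0,
      HasDerivWithinAt (fun s : ℝ => T.S s.toNNReal x) (T.S t.toNNReal y) (Ici 0) t := by
    intro x y h t ht
    have h1 : HasDerivAt (fun t => x + ∫ s in (0 : ℝ)..t, T.S s.toNNReal y)
        (T.S t.toNNReal y) t :=
      (intervalIntegral.integral_hasDerivAt_right ((hcont y).intervalIntegrable _ _)
        ((hcont y).stronglyMeasurableAtFilter _ _) (hcont y).continuousAt).const_add x
    refine h1.hasDerivWithinAt.congr (fun s hs => ?_) ?_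
    · rw [← hint h s hs, add_sub_cancel]
    · rw [← hint h t ht, add_sub_cancel]
  have hgen : ∀ {x y}, (x, y) ∈ A.graph →
      Tendsto (fun t : ℝ≥0 => ((t : ℝ) : 𝕜)⁻¹ • (T.S t x - x)) (𝓝[>] 0) (𝓝 y) := by
    intro x y h
    have h1 := (hasDerivWithinAt_iff_tendsto_slope.1 (hderiv h 0 le_rfl))
    rw [Real.toNNReal_zero, hzero] at h1
    have h2 : Tendsto (fun t : ℝ≥0 => (t : ℝ)) (𝓝[>] 0) (𝓝[Ici 0 \ {0}] 0) := by
      refine tendsto_nhdsWithin_iff.2 ⟨?_, ?_⟩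
      · exact (NNReal.continuous_coe.tendsto' 0 0 rfl).mono_left nhdsWithin_le_nhds
      · filter_upwards [self_mem_nhdsWithin] with t ht
        exact ⟨t.2, by simpa using (ne_of_gt ht)⟩
    refine (h1.comp h2).congr fun t => ?_
    simp [slope_def_module, hzero, RCLike.real_smul_eq_coe_smul (K := 𝕜)]
  -- A mild solution starting at `0` vanishes, by the energy estimate for its primitive.
  have hvanish : ∀ ξ : ℝ → E, IsMildSolution A 0 ξ → ∀ t ≥ 0, ξ t = 0 := by
    intro ξ hξ t ht
    have hi : ∀ s ≥ 0, IntervalIntegrable ξ volume 0 s := fun s hs =>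
      (hξ.1.mono (by rw [uIcc_of_le hs]; exact Icc_subset_Ici_self)).intervalIntegrable
    have hgraph : ∀ s ≥ 0, (∫ r in (0 : ℝ)..s, ξ r, ξ s) ∈ A.graph := fun s hs => by
      simpa using hξ.2 s hs
    have hd : ∀ s > 0, HasDerivAt (fun s => ∫ r in (0 : ℝ)..s, ξ r) (ξ s) s := fun s hs =>
      intervalIntegral.integral_hasDerivAt_right (hi s hs.le)
        ((hξ.1.mono Ioi_subset_Ici_self).stronglyMeasurableAtFilter isOpen_Ioi s hs)
        (hξ.1.continuousAt (Ici_mem_nhds hs))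
    have hc : ContinuousOn (fun s => ∫ r in (0 : ℝ)..s, ξ r) (Ici 0) := by
      intro s hs
      have hs' : (0 : ℝ) ≤ s := hs
      have h1 := intervalIntegral.continuousOn_primitive_interval
        ((intervalIntegrable_iff' (by finiteness)).1 (hi (s + 1) (by linarith)))
      rw [uIcc_of_le (by linarith)] at h1
      refine (h1 s ⟨hs', by linarith⟩).mono_of_mem_nhdsWithin ?_
      rw [← Ici_inter_Iic]
      exact inter_mem self_mem_nhdsWithin
        (mem_nhdsWithin_of_mem_nhds (Iic_mem_nhds (by linarith)))
    have h0 := norm_le_of_re_inner_deriv_nonpos (𝕜 := 𝕜) hc hd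
      (fun s hs => hA.re_inner_le (hgraph s (le_of_lt hs))) ht
    simp only [intervalIntegral.integral_same, norm_zero, norm_le_zero_iff] at h0
    exact A.graph_fst_eq_zero_snd (hgraph t ht) h0
  have hsub : ∀ {x y ξ η}, IsMildSolution A x ξ → IsMildSolution A y η →
      IsMildSolution A (x - y) (fun t => ξ t - η t) := by
    intro x y ξ η hξ hη
    refine ⟨hξ.1.sub hη.1, fun t ht => ?_⟩
    have hu : uIcc 0 t ⊆ Ici 0 := by rw [uIcc_of_le ht]; exact Icc_subset_Ici_self
    rw [intervalIntegral.integral_sub (hξ.1.mono hu).intervalIntegrable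
      (hη.1.mono hu).intervalIntegrable, sub_sub_sub_comm]
    exact A.graph.sub_mem (hξ.2 t ht) (hη.2 t ht)
  have horbit : ∀ x, IsMildSolution A x fun t => T.S t.toNNReal x := fun x =>
    ⟨(hcont x).continuousOn, hmild x⟩
  have huniq : ∀ {x ξ η}, IsMildSolution A x ξ → IsMildSolution A x η → EqOn ξ η (Ici 0) := by
    intro x ξ η hξ hη t ht
    have := hsub hξ hη
    rw [sub_self] at this
    exact sub_eq_zero.1 (hvanish _ this t ht)
  refine ⟨⟨T, fun x y => ⟨hgen, fun h => ?_⟩⟩, fun x => ⟨_, horbit x⟩,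
    fun _ _ _ => huniq, fun x hx ξ hξ => ?_, fun τ _ => ⟨1, fun x y ξ η hξ hη t ht => ?_⟩⟩
  · -- The generator of a contraction semigroup is dissipative, and `A` has no proper dissipative
    -- extension.
    have hdiss : ∀ z w : E,
        Tendsto (fun t : ℝ≥0 => ((t : ℝ) : 𝕜)⁻¹ • (T.S t z - z)) (𝓝[>] 0) (𝓝 w) →
        RCLike.re (inner 𝕜 w z) ≤ 0 := by
      intro z w hw
      refine le_of_tendsto ((RCLike.continuous_re.tendsto _).comp
        (hw.inner (tendsto_const_nhds (x := z)))) (Eventually.of_forall fun t => ?_)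
      simp only [Function.comp_apply]
      rw [inner_smul_left, map_inv₀, RCLike.conj_ofReal, ← RCLike.ofReal_inv,
        RCLike.re_ofReal_mul, inner_sub_left, map_sub, inner_self_eq_norm_sq]
      have h1 := (RCLike.re_le_norm _).trans (norm_inner_le_norm (𝕜 := 𝕜) (T.S t z) z)
      refine mul_nonpos_of_nonneg_of_nonpos (inv_nonneg.2 t.2) ?_
      nlinarith [hT t z, norm_nonneg z]
    obtain ⟨⟨x', y'⟩, hz, hzy⟩ := hA.exists_mem_graph hM one_pos (x - y)
    dsimp only at hz hzy
    rw [RCLike.ofReal_one, one_smul] at hzy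
    have h1 := hdiss (x - x') (y - y') ((h.sub (hgen hz)).congr fun t => by
      rw [map_sub]; module)
    have h2 : y - y' = x - x' := by
      rw [← neg_sub y', ← neg_sub x', sub_eq_sub_iff_sub_eq_sub.1 hzy]
    rw [h2, inner_self_eq_norm_sq] at h1
    have h3 : x - x' = 0 :=
      norm_eq_zero.1 (pow_eq_zero_iff two_ne_zero |>.1 (le_antisymm h1 (sq_nonneg _)))
    rw [h3] at h2
    rwa [sub_eq_zero.1 h3, sub_eq_zero.1 h2]
  · obtain ⟨y, hy⟩ := LinearPMap.mem_domain_iff.1 hx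
    have heq := huniq hξ (horbit x)
    refine ⟨by simpa [hzero] using heq (mem_Ici.2 le_rfl), fun t => T.S t.toNNReal y,
      (hcont y).continuousOn, fun t ht => ⟨(hderiv hy t ht).congr heq (heq ht), ?_⟩⟩
    rw [heq ht]
    exact hinv x y hy _
  · have h1 := huniq (hsub hξ hη) (horbit (x - y)) (mem_Ici.2 ht.1)
    simp only at h1
    rw [h1, one_mul]
    exact hT _ _

end Generation

/-! ### Integration by parts for Sobolev functions -/

section Parts

theorem absolutelyContinuousOnInterval_primitive {F : Type*} [NormedAddCommGroup F]
    [NormedSpace ℝ F] {f : ℝ → F} {a b : ℝ} (h : IntervalIntegrable f volume a b) :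
    AbsolutelyContinuousOnInterval (fun x => ∫ t in a..x, f t) a b := by
  have hsub : ∀ x ∈ uIcc a b, IntervalIntegrable f volume a x := fun x hx =>
    h.mono_set (uIcc_subset_uIcc_left hx)
  have h1 := h.norm.absolutelyContinuousOnInterval_intervalIntegral (left_mem_uIcc (a := a))
  refine squeeze_zero' (Eventually.of_forall fun _ => Finset.sum_nonneg fun _ _ => dist_nonneg)
    ?_ h1
  filter_upwards [mem_inf_of_right (mem_principal_self _)] with I hI
  refine Finset.sum_le_sum fun i hi => ?_
  obtain ⟨hx, hy⟩ := hI.1 i hi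
  rw [dist_eq_norm, dist_eq_norm,
    intervalIntegral.integral_interval_sub_left (hsub _ hx) (hsub _ hy),
    intervalIntegral.integral_interval_sub_left (hsub _ hx).norm (hsub _ hy).norm]
  exact intervalIntegral.norm_integral_le_abs_integral_norm

variable {𝕜 : Type*} [RCLike 𝕜] {a b : ℝ}

/-- The product of two primitives is absolutely continuous, and its derivative is given by the
product rule almost everywhere. -/
theorem integral_mul_add_mul_of_eq_integral (hab : a < b) {f f' g g' : ℝ → 𝕜}
    (hf' : IntervalIntegrable f' volume a b) (hg' : IntervalIntegrable g' volume a b)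
    (hf : ∀ x ∈ Icc a b, f x = f a + ∫ t in a..x, f' t)
    (hg : ∀ x ∈ Icc a b, g x = g a + ∫ t in a..x, g' t) :
    ∫ x in a..b, (f' x * g x + f x * g' x) = f b * g b - f a * g a := by
  set P : ℝ → 𝕜 := fun x => f a + ∫ t in a..x, f' t with hP
  set Q : ℝ → 𝕜 := fun x => g a + ∫ t in a..x, g' t with hQ
  have hconst : ∀ c : 𝕜, AbsolutelyContinuousOnInterval (fun _ : ℝ => c) a b := fun c =>
    (contDiff_const (n := 1)).contDiffOn.absolutelyContinuousOnInterval
  have hPac : AbsolutelyContinuousOnInterval P a b :=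
    (hconst _).add (absolutelyContinuousOnInterval_primitive hf')
  have hQac : AbsolutelyContinuousOnInterval Q a b :=
    (hconst _).add (absolutelyContinuousOnInterval_primitive hg')
  have hi : IntervalIntegrable (fun x => f' x * Q x + P x * g' x) volume a b :=
    (hf'.mul_continuousOn hQac.continuousOn).add (hg'.continuousOn_mul hPac.continuousOn)
  have hH := (hPac.smul hQac).sub (absolutelyContinuousOnInterval_primitive hi)
  obtain ⟨c, hc⟩ := hH.const_of_ae_hasDerivAt_zero (by
    filter_upwards [hf'.ae_hasDerivAt_integral, hg'.ae_hasDerivAt_integral,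
      hi.ae_hasDerivAt_integral] with x h1 h2 h3 hx
    have := (((h1 hx a left_mem_uIcc).const_add (f a)).mul
      ((h2 hx a left_mem_uIcc).const_add (g a))).sub (h3 hx a left_mem_uIcc)
    rw [sub_self] at this
    exact this)
  have ha := hc a left_mem_uIcc
  have hb := hc b right_mem_uIcc
  simp only [Pi.sub_apply, smul_eq_mul, Pi.mul_apply, intervalIntegral.integral_same,
    sub_zero] at ha hb
  have hPf : ∀ x ∈ Icc a b, P x = f x := fun x hx => (hf x hx).symm
  have hQg : ∀ x ∈ Icc a b, Q x = g x := fun x hx => (hg x hx).symm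
  rw [hPf _ (left_mem_Icc.2 hab.le), hQg _ (left_mem_Icc.2 hab.le)] at ha
  rw [hPf _ (right_mem_Icc.2 hab.le), hQg _ (right_mem_Icc.2 hab.le)] at hb
  have h1 : ∫ x in a..b, (f' x * g x + f x * g' x) = ∫ x in a..b, (f' x * Q x + P x * g' x) := by
    refine intervalIntegral.integral_congr fun x hx => ?_
    rw [uIcc_of_le hab.le] at hx
    simp only [hPf x hx, hQg x hx]
  rw [h1, ha, ← hb, sub_sub_cancel]

namespace IsSobolev

variable {n m : ℕ} {d e : ℕ → ℝ → 𝕜}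

theorem of_le (hab : a ≤ b) (h : IsSobolev n a b d) (hm : m ≤ n) : IsSobolev m a b d where
  memLp := by
    rcases hm.eq_or_lt with rfl | hm
    · exact h.memLp
    · exact memLp_of_continuousOn (h.continuousOn hab hm)
  eq_integral j hj := h.eq_integral j (hj.trans_le hm)

theorem mono {a' b' : ℝ} (hab : a ≤ b) (h : IsSobolev n a b d) (ha : a ≤ a') (hb : b' ≤ b) :
    IsSobolev n a' b' d where
  memLp := h.memLp.mono_measure (Measure.restrict_mono (Ioo_subset_Ioo ha hb) le_rfl)
  eq_integral j hj x hx := by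
    have hx' : x ∈ Icc a b := ⟨ha.trans hx.1, hx.2.trans hb⟩
    have ha' : a' ∈ Icc a b := ⟨ha, hx.1.trans hx'.2⟩
    rw [h.eq_integral j hj x hx', h.eq_integral j hj a' ha', add_assoc,
      intervalIntegral.integral_add_adjacent_intervals (h.integrable_sub hab hj ha')
        ((h.integrable_sub hab hj ha').symm.trans (h.integrable_sub hab hj hx'))]

theorem conj (h : IsSobolev n a b d) :
    IsSobolev n a b fun j x => (starRingEnd 𝕜) (d j x) where
  memLp := by
    refine h.memLp.of_le (RCLike.continuous_conj.comp_aestronglyMeasurable h.memLp.1) ?_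
    exact Eventually.of_forall fun x => by simp
  eq_integral j hj x hx := by
    rw [h.eq_integral j hj x hx, map_add]
    congr 1
    simp only [intervalIntegral, integral_conj, map_sub]

theorem ae_eq (hab : a < b) (h : IsSobolev n a b d) (h' : IsSobolev n a b e)
    (h0 : d 0 =ᵐ[volume.restrict (Ioo a b)] e 0) {j : ℕ} (hj : j ≤ n) :
    d j =ᵐ[volume.restrict (Ioo a b)] e j := by
  have h1 := (h.add hab.le (h'.smul (-1))).ae_eq_zero hab (by
    filter_upwards [h0] with x hx
    simp [hx]) hj
  filter_upwards [h1] with x hx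
  simpa [← sub_eq_add_neg, sub_eq_zero] using hx

/-- A function with a second derivative in `H^m` belongs to `H^(m + 2)`. -/
theorem append (h : IsSobolev 2 a b d) (h' : IsSobolev m a b e)
    (h2 : d 2 =ᵐ[volume.restrict (Ioo a b)] e 0) :
    IsSobolev (m + 2) a b fun j => if j < 2 then d j else e (j - 2) where
  memLp := by simpa using h'.memLp
  eq_integral j hj x hx := by
    rcases lt_trichotomy j 1 with h1 | rfl | h1
    · obtain rfl : j = 0 := by lia
      simpa using h.eq_integral 0 two_pos x hx
    · simp only [Nat.one_lt_two, if_true, lt_irrefl, if_false, Nat.reduceAdd, Nat.sub_self]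
      rw [h.eq_integral 1 one_lt_two x hx]
      congr 1
      refine intervalIntegral.integral_congr_ae_restrict ?_
      rw [uIoc_of_le hx.1, ← restrict_Ioo_eq_restrict_Ioc]
      exact ae_mono (Measure.restrict_mono (Ioo_subset_Ioo_right hx.2) le_rfl) h2
    · simp only [show ¬ j < 2 by lia, show ¬ j + 1 < 2 by lia, if_false]
      rw [show j + 1 - 2 = j - 2 + 1 by lia]
      exact h'.eq_integral (j - 2) (by lia) x hx

/-- The affine function `x ↦ c + k x`, with its derivatives. -/
theorem affine (c k : 𝕜) :
    IsSobolev 2 a b fun j x => if j = 0 then c + k * x else if j = 1 then k else 0 where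
  memLp := by simp
  eq_integral j hj x hx := by
    interval_cases j
    · simp [RCLike.real_smul_eq_coe_mul]
      ring
    · simp

theorem integral_mul_add_mul (hab : a < b) (h : IsSobolev n a b d) (h' : IsSobolev m a b e)
    {i j : ℕ} (hi : i < n) (hj : j < m) :
    ∫ x in a..b, (d (i + 1) x * e j x + d i x * e (j + 1) x)
      = d i b * e j b - d i a * e j a :=
  integral_mul_add_mul_of_eq_integral hab (h.intervalIntegrable hab.le hi)
    (h'.intervalIntegrable hab.le hj) (h.eq_integral i hi) (h'.eq_integral j hj)

theorem integral_mul_eq (hab : a < b) (h : IsSobolev n a b d) (h' : IsSobolev m a b e)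
    {i j : ℕ} (hi : i < n) (hj : j < m) :
    ∫ x in a..b, d (i + 1) x * e j x
      = d i b * e j b - d i a * e j a - ∫ x in a..b, d i x * e (j + 1) x := by
  rw [← h.integral_mul_add_mul hab h' hi hj, intervalIntegral.integral_add, add_sub_cancel_right]
  · refine (h.intervalIntegrable hab.le hi).mul_continuousOn ?_
    rw [uIcc_of_le hab.le]
    exact h'.continuousOn hab.le hj
  · refine (h'.intervalIntegrable hab.le hj).continuousOn_mul ?_
    rw [uIcc_of_le hab.le]
    exact h.continuousOn hab.le hi

/-- Two integrations by parts, moving two derivatives from `d` to `e`. -/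
theorem integral_two_mul_two (hab : a < b) (h : IsSobolev 2 a b d) (h' : IsSobolev 4 a b e) :
    ∫ x in a..b, d 2 x * e 2 x = d 1 b * e 2 b - d 1 a * e 2 a - (d 0 b * e 3 b - d 0 a * e 3 a)
      + ∫ x in a..b, d 0 x * e 4 x := by
  have h1 : ∫ x in a..b, d 2 x * e 2 x
      = d 1 b * e 2 b - d 1 a * e 2 a - ∫ x in a..b, d 1 x * e 3 x :=
    h.integral_mul_eq hab h' one_lt_two (by norm_num)
  have h2 : ∫ x in a..b, d 1 x * e 3 x
      = d 0 b * e 3 b - d 0 a * e 3 a - ∫ x in a..b, d 0 x * e 4 x :=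
    h.integral_mul_eq hab h' two_pos (by norm_num)
  rw [h1, h2]
  ring

end IsSobolev

/-- Green's formula for the beam: `u''` is continuous at the interface `c` and vanishes at the ends
of the beam, and a jump of `u'''` at `c` contributes a boundary term. The test function `e` is
`H²` across the interface. -/
theorem green_formula {c : ℝ} (hac : a < c) (hcb : c < b) {e d d' : ℕ → ℝ → 𝕜}
    (he : IsSobolev 2 a b e) (hea : e 0 a = 0) (heb : e 0 b = 0)
    (hd : IsSobolev 4 a c d) (hd' : IsSobolev 4 c b d')
    (ha : d 2 a = 0) (hb : d' 2 b = 0) (hc : d 2 c = d' 2 c) :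
    (∫ x in a..c, (starRingEnd 𝕜) (e 2 x) * d 2 x) + ∫ x in c..b, (starRingEnd 𝕜) (e 2 x) * d' 2 x
      = (∫ x in a..c, (starRingEnd 𝕜) (e 0 x) * d 4 x)
        + (∫ x in c..b, (starRingEnd 𝕜) (e 0 x) * d' 4 x)
        - (starRingEnd 𝕜) (e 0 c) * (d 3 c - d' 3 c) := by
  have hab := hac.trans hcb
  have h1 := (he.mono hab.le le_rfl hcb.le).conj.integral_two_mul_two hac hd
  have h2 := (he.mono hab.le hac.le le_rfl).conj.integral_two_mul_two hcb hd'
  rw [h1, h2, ha, hb, hc, hea, heb]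
  simp only [map_zero]
  ring

end Parts

namespace Beam

variable {B : Beam} {𝕜 : Type*} [RCLike 𝕜]

/-! ### Estimates in the state space -/

/-- The inner product of `L²(0, l)` as a sum of integrals over `(0, l₀)` and `(l₀, l)`. -/
theorem inner_eq_integral_add {f g : L2 𝕜 B.l} {φ a b : ℝ → 𝕜}
    (hf : f =ᵐ[volume.restrict (Ioo 0 B.l)] φ) (ha : g =ᵐ[volume.restrict (Ioo 0 B.l₀)] a)
    (hb : g =ᵐ[volume.restrict (Ioo B.l₀ B.l)] b) :
    inner 𝕜 f g = (∫ x in (0 : ℝ)..B.l₀, (starRingEnd 𝕜) (φ x) * a x)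
      + ∫ x in B.l₀..B.l, (starRingEnd 𝕜) (φ x) * b x := by
  have hi : IntervalIntegrable (fun x => inner 𝕜 (f x) (g x)) volume 0 B.l := by
    rw [intervalIntegrable_iff_integrableOn_Ioo_of_le B.l_pos.le]
    exact L2.integrable_inner f g
  rw [L2.inner_def, ← integral_Ioc_eq_integral_Ioo,
    ← intervalIntegral.integral_of_le B.l_pos.le,
    ← intervalIntegral.integral_add_adjacent_intervals
      (hi.mono_set (uIcc_subset_uIcc_left (by rw [uIcc_of_le B.l_pos.le]; exact B.l₀_mem)))
      (hi.mono_set (uIcc_subset_uIcc_right (by rw [uIcc_of_le B.l_pos.le]; exact B.l₀_mem)))]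
  congr 1
  · refine intervalIntegral.integral_congr_ae_restrict ?_
    rw [uIoc_of_le B.l₀_pos.le, ← restrict_Ioo_eq_restrict_Ioc]
    filter_upwards [Feedback.ae_left hf, ha] with x h1 h2
    rw [h1, h2, RCLike.inner_apply, mul_comm]
  · refine intervalIntegral.integral_congr_ae_restrict ?_
    rw [uIoc_of_le B.l₀_lt.le, ← restrict_Ioo_eq_restrict_Ioc]
    filter_upwards [Feedback.ae_right hf, hb] with x h1 h2
    rw [h1, h2, RCLike.inner_apply, mul_comm]

namespace X

theorem integral_norm_d2u_le : ∃ C : ℝ, 0 ≤ C ∧ ∀ (ξ : B.X 𝕜) (d : ℕ → ℝ → 𝕜),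
    IsH2Zero B.l (u ξ) d → ∫ t in (0 : ℝ)..B.l, ‖d 2 t‖ ≤ C * ‖d2u ξ‖ := by
  have : IsFiniteMeasure (volume.restrict (Ioo 0 B.l)) := inferInstance
  let one : Lp ℝ 2 (volume.restrict (Ioo 0 B.l)) := (memLp_const (1 : ℝ)).toLp _
  refine ⟨‖one‖, norm_nonneg _, fun ξ d hd => ?_⟩
  have hn : MemLp (fun x => ‖d2u ξ x‖) 2 (volume.restrict (Ioo 0 B.l)) := (Lp.memLp _).norm
  have h1 : ∫ t in (0 : ℝ)..B.l, ‖d 2 t‖ = inner ℝ one (hn.toLp _) := by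
    rw [L2.inner_def, intervalIntegral.integral_of_le B.l_pos.le, ← restrict_Ioo_eq_restrict_Ioc]
    refine integral_congr_ae ?_
    filter_upwards [d2u_ae_eq ξ hd, hn.coeFn_toLp,
      (memLp_const (μ := volume.restrict (Ioo 0 B.l)) (p := 2) (1 : ℝ)).coeFn_toLp] with x h h' h''
    simp only [one]
    rw [h', h'', h]
    simp
  rw [h1]
  refine (real_inner_le_norm _ _).trans (mul_le_mul_of_nonneg_left ?_ (norm_nonneg _))
  rw [Lp.norm_toLp, Lp.norm_def, eLpNorm_norm]

/-- The Poincaré inequality. -/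
theorem norm_u_le : ∃ C : ℝ, 0 ≤ C ∧ ∀ ξ : B.X 𝕜, ‖u ξ‖ ≤ C * ‖d2u ξ‖ := by
  obtain ⟨C, hC, h⟩ := integral_norm_d2u_le (B := B) (𝕜 := 𝕜)
  have hl := B.l_pos
  refine ⟨measureUnivNNReal (volume.restrict (Ioo 0 B.l)) ^ (2 : ℝ≥0∞).toReal⁻¹
    * (2 * B.l * C), by positivity, fun ξ => ?_⟩
  obtain ⟨d, hd, -⟩ := exists_rep ξ
  rw [mul_assoc]
  refine Lp.norm_le_of_ae_bound (by positivity) ?_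
  filter_upwards [hd.ae_eq, ae_restrict_mem measurableSet_Ioo] with x hx hx'
  rw [hx, mul_assoc]
  exact (hd.norm_le hl (Ioo_subset_Icc_self hx')).trans
    (mul_le_mul_of_nonneg_left (h ξ d hd) (by positivity))

theorem norm_components_le : ∃ C : ℝ, 0 < C ∧ ∀ ξ : B.X 𝕜,
    ‖d2u ξ‖ ≤ C * ‖ξ‖ ∧ ‖v ξ‖ ≤ C * ‖ξ‖ ∧ ‖p ξ‖ ≤ C * ‖ξ‖ ∧ ‖q ξ‖ ≤ C * ‖ξ‖ := by
  have hEI := mul_pos B.E_pos B.I_pos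
  have hρ := B.ρ_pos; have hκ := B.κ_pos; have hm := B.m_pos
  have aux : ∀ {c s t : ℝ}, 0 < c → 0 ≤ t → c * s ^ 2 ≤ t ^ 2 → s ≤ (√c)⁻¹ * t := by
    intro c s t hc ht h
    have hc' := Real.sqrt_pos.2 hc
    rw [inv_mul_eq_div, le_div_iff₀ hc']
    refine le_of_sq_le_sq ?_ ht
    rw [mul_pow, Real.sq_sqrt hc.le, mul_comm]
    exact h
  refine ⟨(√(B.E * B.I))⁻¹ + (√B.ρ)⁻¹ + (√B.κ)⁻¹ + (√B.m)⁻¹, by positivity, fun ξ => ?_⟩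
  have h0 := norm_sq ξ
  have hn := norm_nonneg ξ
  have h1 : 0 ≤ B.E * B.I * ‖d2u ξ‖ ^ 2 := by positivity
  have h2 : 0 ≤ B.ρ * ‖v ξ‖ ^ 2 := by positivity
  have h3 : 0 ≤ B.κ * ‖p ξ‖ ^ 2 := by positivity
  have h4 : 0 ≤ B.m * ‖q ξ‖ ^ 2 := by positivity
  have g1 : 0 ≤ (√(B.E * B.I))⁻¹ := by positivity
  have g2 : 0 ≤ (√B.ρ)⁻¹ := by positivity
  have g3 : 0 ≤ (√B.κ)⁻¹ := by positivity
  have g4 : 0 ≤ (√B.m)⁻¹ := by positivity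
  refine ⟨(aux hEI hn (by linarith)).trans ?_, (aux hρ hn (by linarith)).trans ?_,
    (aux hκ hn (by linarith)).trans ?_, (aux hm hn (by linarith)).trans ?_⟩ <;>
  · refine mul_le_mul_of_nonneg_right ?_ hn
    linarith

theorem norm_le_of_components : ∃ C : ℝ, 0 ≤ C ∧ ∀ (ξ : B.X 𝕜) (M : ℝ), 0 ≤ M → ‖d2u ξ‖ ≤ M →
    ‖v ξ‖ ≤ M → ‖p ξ‖ ≤ M → ‖q ξ‖ ≤ M → ‖ξ‖ ≤ C * M := by
  have hEI := mul_pos B.E_pos B.I_pos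
  have hρ := B.ρ_pos; have hκ := B.κ_pos; have hm := B.m_pos
  refine ⟨√(B.E * B.I + B.ρ + B.κ + B.m), Real.sqrt_nonneg _, fun ξ M hM h1 h2 h3 h4 => ?_⟩
  refine le_of_sq_le_sq ?_ (by positivity)
  rw [norm_sq, mul_pow, Real.sq_sqrt (by positivity), add_mul, add_mul, add_mul]
  gcongr

end X

end Beam

namespace Beam

namespace Feedback

variable {B : Beam} {k : ℕ} (K : B.Feedback k) {𝕜 : Type*} [RCLike 𝕜]

/-! ### The weak form of the closed-loop operator -/

theorem memLp_ddψ (j : Fin k) :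
    MemLp (fun x => (K.ddψ j x : 𝕜)) 2 (volume.restrict (Ioo 0 B.l)) :=
  memLp_of_continuousOn (RCLike.continuous_ofReal.comp_continuousOn
    ((K.contDiffOn j).continuousOn_iteratedDerivWithin (m := 2) (by norm_num)
      (uniqueDiffOn_Icc B.l_pos)))

/-- `ψ j''` as an element of `L²(0, l)`. -/
def shape (𝕜 : Type*) [RCLike 𝕜] (j : Fin k) : L2 𝕜 B.l := (K.memLp_ddψ j).toLp _

theorem torque_eq_inner (ξ : B.X 𝕜) (j : Fin k) :
    K.torque ξ j = -(K.α j : 𝕜) * inner 𝕜 (K.shape 𝕜 j) (X.v ξ) := by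
  rw [torque, L2.inner_def]
  congr 1
  refine integral_congr_ae ?_
  filter_upwards [(K.memLp_ddψ (𝕜 := 𝕜) j).coeFn_toLp] with x hx
  rw [shape, hx, RCLike.inner_apply, RCLike.conj_ofReal, mul_comm]

/-- The function `(E I)⁻¹ (∑ j, ψ j'' M j - ρ f)`, which the fourth derivative of the deflection
has to equal when the velocity component of `Ã ξ` is `f`. -/
def load (ξ : B.X 𝕜) (f : L2 𝕜 B.l) : L2 𝕜 B.l :=
  ((B.E : 𝕜) * B.I)⁻¹ • (∑ j, K.torque ξ j • K.shape 𝕜 j - (B.ρ : 𝕜) • f)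

theorem coeFn_load (ξ : B.X 𝕜) (f : L2 𝕜 B.l) :
    K.load ξ f =ᵐ[volume.restrict (Ioo 0 B.l)] fun x =>
      ((B.E : 𝕜) * B.I)⁻¹ * (∑ j, (K.ddψ j x : 𝕜) * K.torque ξ j - (B.ρ : 𝕜) * f x) := by
  have h1 : ∀ᵐ x ∂volume.restrict (Ioo 0 B.l), ∀ j,
      (K.torque ξ j • K.shape 𝕜 j : L2 𝕜 B.l) x = (K.ddψ j x : 𝕜) * K.torque ξ j := by
    refine ae_all_iff.2 fun j => ?_
    filter_upwards [Lp.coeFn_smul (K.torque ξ j) (K.shape 𝕜 j),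
      (K.memLp_ddψ (𝕜 := 𝕜) j).coeFn_toLp] with x h h'
    rw [h, Pi.smul_apply, shape, h', smul_eq_mul, mul_comm]
  have h2 := Lp.coeFn_finsetSum Finset.univ fun j => K.torque ξ j • K.shape 𝕜 j
  filter_upwards [h1, h2, Lp.coeFn_smul ((B.E : 𝕜) * B.I)⁻¹
      (∑ j, K.torque ξ j • K.shape 𝕜 j - (B.ρ : 𝕜) • f),
    Lp.coeFn_sub (∑ j, K.torque ξ j • K.shape 𝕜 j) ((B.ρ : 𝕜) • f),
    Lp.coeFn_smul (B.ρ : 𝕜) f] with x g1 g2 g3 g4 g5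
  rw [load, g3, Pi.smul_apply, g4, Pi.sub_apply, g5, Pi.smul_apply, smul_eq_mul, smul_eq_mul, g2,
    Finset.sum_apply]
  simp only [g1]

/-- The pointwise equation for the velocity component, solved for the fourth derivative. -/
theorem eq_fourth_deriv_iff (y f s : 𝕜) :
    f = -(1 / (B.ρ : 𝕜)) * ((B.E : 𝕜) * B.I * y) + 1 / (B.ρ : 𝕜) * s
      ↔ ((B.E : 𝕜) * B.I)⁻¹ * (s - (B.ρ : 𝕜) * f) = y := by
  have hE : (B.E : 𝕜) ≠ 0 := by exact_mod_cast B.E_pos.ne'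
  have hI : (B.I : 𝕜) ≠ 0 := by exact_mod_cast B.I_pos.ne'
  have hρ : (B.ρ : 𝕜) ≠ 0 := by exact_mod_cast B.ρ_pos.ne'
  constructor
  · rintro rfl
    field_simp
    ring
  · rintro rfl
    field_simp
    ring

theorem InDomain.d2u_left {ξ : B.X 𝕜} {a b : ℕ → ℝ → 𝕜} (h : InDomain ξ a b) :
    X.d2u ξ =ᵐ[volume.restrict (Ioo 0 B.l₀)] a 2 := by
  obtain ⟨d, hd, -⟩ := X.exists_rep ξ
  refine EventuallyEq.trans (ae_left (X.d2u_ae_eq ξ hd)) ?_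
  exact (hd.sobolev.mono B.l_pos.le le_rfl B.l₀_lt.le).ae_eq B.l₀_pos
    (h.sobolev_left.of_le B.l₀_pos.le (by norm_num))
    ((show _ =ᵐ[_] _ from ae_left hd.ae_eq).symm.trans h.u_left) le_rfl

theorem InDomain.d2u_right {ξ : B.X 𝕜} {a b : ℕ → ℝ → 𝕜} (h : InDomain ξ a b) :
    X.d2u ξ =ᵐ[volume.restrict (Ioo B.l₀ B.l)] b 2 := by
  obtain ⟨d, hd, -⟩ := X.exists_rep ξ
  refine EventuallyEq.trans (ae_right (X.d2u_ae_eq ξ hd)) ?_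
  exact (hd.sobolev.mono B.l_pos.le B.l₀_pos.le le_rfl).ae_eq B.l₀_lt
    (h.sobolev_right.of_le B.l₀_lt.le (by norm_num))
    ((show _ =ᵐ[_] _ from ae_right hd.ae_eq).symm.trans h.u_right) le_rfl

/-- Green's formula in the state space: `ζ` supplies the test function. -/
theorem inner_d2u_eq {ζ ξ : B.X 𝕜} {a b : ℕ → ℝ → 𝕜} {h : L2 𝕜 B.l}
    (ha : IsSobolev 4 0 B.l₀ a) (hb : IsSobolev 4 B.l₀ B.l b)
    (hξa : X.d2u ξ =ᵐ[volume.restrict (Ioo 0 B.l₀)] a 2)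
    (hξb : X.d2u ξ =ᵐ[volume.restrict (Ioo B.l₀ B.l)] b 2)
    (h0 : a 2 0 = 0) (hl : b 2 B.l = 0) (hi : a 2 B.l₀ = b 2 B.l₀)
    (h4a : h =ᵐ[volume.restrict (Ioo 0 B.l₀)] a 4)
    (h4b : h =ᵐ[volume.restrict (Ioo B.l₀ B.l)] b 4) :
    inner 𝕜 (X.d2u ζ) (X.d2u ξ)
      = inner 𝕜 (X.u ζ) h - (starRingEnd 𝕜) (X.p ζ) * (a 3 B.l₀ - b 3 B.l₀) := by
  obtain ⟨e, he, hp⟩ := X.exists_rep ζ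
  rw [inner_eq_integral_add (X.d2u_ae_eq ζ he) hξa hξb, inner_eq_integral_add he.ae_eq h4a h4b, hp]
  exact green_formula B.l₀_pos B.l₀_lt he.sobolev he.left he.right ha hb h0 hl hi

/-- The weak form of `η = Ã ξ`. -/
theorem weak_form {ξ η : B.X 𝕜} (h : (ξ, η) ∈ (K.closedLoop 𝕜).graph) (ζ : B.X 𝕜) :
    ((B.E * B.I : ℝ) : 𝕜) * inner 𝕜 (X.d2u ζ) (X.d2u ξ) + (B.ρ : 𝕜) * inner 𝕜 (X.u ζ) (X.v η)
      + (B.κ : 𝕜) * inner 𝕜 (X.p ζ) (X.p ξ) + (B.m : 𝕜) * inner 𝕜 (X.p ζ) (X.q η)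
    = inner 𝕜 (X.u ζ) (∑ j, K.torque ξ j • K.shape 𝕜 j) + inner 𝕜 (X.p ζ) (K.force ξ) := by
  obtain ⟨a, b, hd, hi⟩ := K.mem_graph_closedLoop.1 h
  have hE : (B.E : 𝕜) ≠ 0 := by exact_mod_cast B.E_pos.ne'
  have hI : (B.I : 𝕜) ≠ 0 := by exact_mod_cast B.I_pos.ne'
  have hm : (B.m : 𝕜) ≠ 0 := by exact_mod_cast B.m_pos.ne'
  have h4a : K.load ξ (X.v η) =ᵐ[volume.restrict (Ioo 0 B.l₀)] a 4 := by
    filter_upwards [ae_left (K.coeFn_load ξ (X.v η)), hi.v_left] with x hx hx'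
    rw [hx]
    exact (eq_fourth_deriv_iff _ _ _).1 hx'
  have h4b : K.load ξ (X.v η) =ᵐ[volume.restrict (Ioo B.l₀ B.l)] b 4 := by
    filter_upwards [ae_right (K.coeFn_load ξ (X.v η)), hi.v_right] with x hx hx'
    rw [hx]
    exact (eq_fourth_deriv_iff _ _ _).1 hx'
  rw [inner_d2u_eq hd.sobolev_left hd.sobolev_right hd.d2u_left hd.d2u_right hd.bc_zero hd.bc_l
    hd.interface h4a h4b, load, inner_smul_right, inner_sub_right, inner_smul_right, hi.q_eq]
  simp only [RCLike.inner_apply, RCLike.ofReal_mul]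
  field_simp
  ring

theorem isDissipative_closedLoop : IsDissipative (K.closedLoop 𝕜) := by
  intro x
  have hg := (K.closedLoop 𝕜).mem_graph x
  set ξ : B.X 𝕜 := (x : B.X 𝕜)
  set η : B.X 𝕜 := K.closedLoop 𝕜 x
  obtain ⟨a, b, hd, hi⟩ := K.mem_graph_closedLoop.1 hg
  have h := K.weak_form hg η
  have h1 : inner 𝕜 η ξ = inner 𝕜 (X.v ξ) (∑ j, K.torque ξ j • K.shape 𝕜 j)
      + inner 𝕜 (X.q ξ) (K.force ξ) + ((B.ρ : 𝕜) * inner 𝕜 (X.v η) (X.v ξ)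
        - (B.ρ : 𝕜) * inner 𝕜 (X.v ξ) (X.v η)) + ((B.m : 𝕜) * inner 𝕜 (X.q η) (X.q ξ)
        - (B.m : 𝕜) * inner 𝕜 (X.q ξ) (X.q η)) := by
    rw [hi.u_eq, hi.p_eq] at h
    rw [← h, X.inner_def, hi.p_eq]
    ring
  rw [h1]
  simp only [map_add, map_sub, RCLike.re_ofReal_mul]
  rw [inner_re_symm (X.v η), inner_re_symm (X.q η), sub_self, sub_self, add_zero, add_zero,
    inner_sum, map_sum]
  refine add_nonpos (Finset.sum_nonpos fun j _ => ?_) ?_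
  · rw [inner_smul_right, K.torque_eq_inner, mul_assoc, mul_comm (inner 𝕜 _ _),
      ← RCLike.ofReal_neg, RCLike.re_ofReal_mul, inner_mul_symm_re_eq_norm]
    exact mul_nonpos_of_nonpos_of_nonneg (neg_nonpos.2 (K.α_pos j).le) (norm_nonneg _)
  · rw [force, neg_mul, inner_neg_right, ← smul_eq_mul, inner_smul_right, map_neg,
      RCLike.re_ofReal_mul, inner_self_eq_norm_sq]
    have := K.α₀_pos
    have : 0 ≤ K.α₀ * ‖X.q ξ‖ ^ 2 := by positivity
    linarith

/-! ### Bounded invertibility of the closed-loop operator -/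

theorem norm_torque_smul_le : ∃ C : ℝ, 0 ≤ C ∧ ∀ ξ : B.X 𝕜,
    ‖∑ j, K.torque ξ j • K.shape 𝕜 j‖ ≤ C * ‖X.v ξ‖ := by
  have hα := fun j => (K.α_pos j).le
  refine ⟨∑ j, K.α j * ‖K.shape 𝕜 j‖ * ‖K.shape 𝕜 j‖,
    Finset.sum_nonneg fun j _ => by have := hα j; positivity, fun ξ => ?_⟩
  rw [Finset.sum_mul]
  refine (norm_sum_le _ _).trans (Finset.sum_le_sum fun j _ => ?_)
  have h1 := norm_inner_le_norm (𝕜 := 𝕜) (K.shape 𝕜 j) (X.v ξ)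
  rw [norm_smul, K.torque_eq_inner, norm_mul, norm_neg, RCLike.norm_ofReal, abs_of_nonneg (hα j)]
  calc K.α j * ‖inner 𝕜 (K.shape 𝕜 j) (X.v ξ)‖ * ‖K.shape 𝕜 j‖
      ≤ K.α j * (‖K.shape 𝕜 j‖ * ‖X.v ξ‖) * ‖K.shape 𝕜 j‖ := by
        have := hα j
        gcongr
    _ = K.α j * ‖K.shape 𝕜 j‖ * ‖K.shape 𝕜 j‖ * ‖X.v ξ‖ := by ring

/-- `Ã` is bounded below: test the weak form with `ξ` itself, and note that the velocities of `ξ`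
are the positions of `Ã ξ`. -/
theorem norm_le_norm_closedLoop : ∃ C : ℝ, 0 ≤ C ∧ ∀ ξ η : B.X 𝕜,
    (ξ, η) ∈ (K.closedLoop 𝕜).graph → ‖ξ‖ ≤ C * ‖η‖ := by
  obtain ⟨C, hC, hcomp⟩ := X.norm_components_le (B := B) (𝕜 := 𝕜)
  obtain ⟨U, hU, hu⟩ := X.norm_u_le (B := B) (𝕜 := 𝕜)
  obtain ⟨P, hP, hp⟩ := X.norm_p_le (B := B) (𝕜 := 𝕜)
  obtain ⟨N, hN, hn⟩ := X.norm_le_of_components (B := B) (𝕜 := 𝕜)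
  obtain ⟨S, hS, hs⟩ := K.norm_torque_smul_le (𝕜 := 𝕜)
  have hEI := mul_pos B.E_pos B.I_pos
  have hρ := B.ρ_pos; have hκ := B.κ_pos; have hm := B.m_pos; have hα := K.α₀_pos
  set D := (B.E * B.I)⁻¹ * (U * (S * U + B.ρ) + P * (K.α₀ + B.m)) * C with hD
  have hD0 : 0 ≤ D := by positivity
  refine ⟨N * (D + U * C + P * D + C), by positivity, fun ξ η h => ?_⟩
  obtain ⟨a, b, -, hi⟩ := K.mem_graph_closedLoop.1 h
  obtain ⟨c1, c2, c3, c4⟩ := hcomp η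
  have hη := norm_nonneg η
  have hv : ‖X.v ξ‖ ≤ U * (C * ‖η‖) := by
    rw [← hi.u_eq]
    exact (hu η).trans (mul_le_mul_of_nonneg_left c1 hU)
  have hq : ‖X.q ξ‖ ≤ C * ‖η‖ := by rwa [← hi.p_eq]
  have hw := congrArg RCLike.re (K.weak_form h ξ)
  simp only [map_add, RCLike.re_ofReal_mul, inner_self_eq_norm_sq] at hw
  have e1 : RCLike.re (inner 𝕜 (X.u ξ) (∑ j, K.torque ξ j • K.shape 𝕜 j))
      ≤ U * ‖X.d2u ξ‖ * (S * (U * (C * ‖η‖))) := by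
    refine (RCLike.re_le_norm _).trans ((norm_inner_le_norm _ _).trans ?_)
    exact mul_le_mul (hu ξ) ((hs ξ).trans (mul_le_mul_of_nonneg_left hv hS)) (norm_nonneg _)
      (by positivity)
  have e2 : -RCLike.re (inner 𝕜 (X.u ξ) (X.v η)) ≤ U * ‖X.d2u ξ‖ * (C * ‖η‖) := by
    refine ((neg_le_abs _).trans (RCLike.abs_re_le_norm _)).trans
      ((norm_inner_le_norm _ _).trans ?_)
    exact mul_le_mul (hu ξ) c2 (norm_nonneg _) (by positivity)
  have e3 : RCLike.re (inner 𝕜 (X.p ξ) (K.force ξ)) ≤ P * ‖X.d2u ξ‖ * (K.α₀ * (C * ‖η‖)) := by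
    refine (RCLike.re_le_norm _).trans ((norm_inner_le_norm _ _).trans ?_)
    refine mul_le_mul (hp ξ) ?_ (norm_nonneg _) (by positivity)
    rw [force, norm_mul, norm_neg, RCLike.norm_ofReal, abs_of_pos hα]
    exact mul_le_mul_of_nonneg_left hq hα.le
  have e4 : -RCLike.re (inner 𝕜 (X.p ξ) (X.q η)) ≤ P * ‖X.d2u ξ‖ * (C * ‖η‖) := by
    refine ((neg_le_abs _).trans (RCLike.abs_re_le_norm _)).trans
      ((norm_inner_le_norm _ _).trans ?_)
    exact mul_le_mul (hp ξ) c4 (norm_nonneg _) (by positivity)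
  have hkey : B.E * B.I * ‖X.d2u ξ‖ ^ 2
      ≤ ‖X.d2u ξ‖ * ((U * (S * U + B.ρ) + P * (K.α₀ + B.m)) * (C * ‖η‖)) := by
    have h5 : 0 ≤ B.κ * ‖X.p ξ‖ ^ 2 := by positivity
    have h6 := mul_le_mul_of_nonneg_left e2 hρ.le
    have h7 := mul_le_mul_of_nonneg_left e4 hm.le
    linear_combination hw + e1 + h6 + e3 + h7 + h5
  have hd : ‖X.d2u ξ‖ ≤ D * ‖η‖ := by
    rcases (norm_nonneg (X.d2u ξ)).eq_or_lt with h0 | h0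
    · rw [← h0]
      positivity
    · rw [sq, ← mul_assoc, mul_comm, mul_le_mul_iff_right₀ h0] at hkey
      rw [hD, mul_assoc, mul_assoc, inv_mul_eq_div, le_div_iff₀ hEI, mul_comm]
      exact hkey
  have hpξ : ‖X.p ξ‖ ≤ P * (D * ‖η‖) := (hp ξ).trans (mul_le_mul_of_nonneg_left hd hP)
  have t1 : 0 ≤ D * ‖η‖ := by positivity
  have t2 : 0 ≤ U * (C * ‖η‖) := by positivity
  have t3 : 0 ≤ P * (D * ‖η‖) := by positivity
  have t4 : 0 ≤ C * ‖η‖ := by positivity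
  rw [mul_assoc]
  refine hn ξ _ (by positivity) ?_ ?_ ?_ ?_ <;> linarith

/-- The continuous, piecewise affine function with `tent 0 = tent l = 0` whose derivative drops by
`1` at `l₀`. -/
def tent (B : Beam) (𝕜 : Type*) [RCLike 𝕜] (x : ℝ) : 𝕜 :=
  ((min ((B.l - B.l₀) / B.l * x) (B.l₀ / B.l * (B.l - x)) : ℝ) : 𝕜)

theorem memLp_tent : MemLp (tent B 𝕜) 2 (volume.restrict (Ioo 0 B.l)) := by
  refine memLp_of_continuousOn (Continuous.continuousOn ?_)
  exact RCLike.continuous_ofReal.comp (by fun_prop)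

/-- The derivatives of `tent` on `[0, l₀]`. -/
def tentLeft (B : Beam) (𝕜 : Type*) [RCLike 𝕜] (j : ℕ) (x : ℝ) : 𝕜 :=
  if j = 0 then 0 + ((B.l - B.l₀) / B.l : 𝕜) * x else if j = 1 then ((B.l - B.l₀) / B.l : 𝕜) else 0

/-- The derivatives of `tent` on `[l₀, l]`. -/
def tentRight (B : Beam) (𝕜 : Type*) [RCLike 𝕜] (j : ℕ) (x : ℝ) : 𝕜 :=
  if j = 0 then (B.l₀ : 𝕜) + (-(B.l₀ / B.l) : 𝕜) * x else if j = 1 then (-(B.l₀ / B.l) : 𝕜) else 0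

theorem isSobolev_tentLeft {a b : ℝ} : IsSobolev 2 a b (tentLeft B 𝕜) := IsSobolev.affine _ _

theorem isSobolev_tentRight {a b : ℝ} : IsSobolev 2 a b (tentRight B 𝕜) := IsSobolev.affine _ _

theorem tentLeft_zero : tentLeft B 𝕜 0 0 = 0 := by simp [tentLeft]

theorem tentRight_l : tentRight B 𝕜 0 B.l = 0 := by
  have hl : (B.l : 𝕜) ≠ 0 := by exact_mod_cast B.l_pos.ne'
  rw [tentRight, if_pos rfl]
  field_simp
  ring

theorem tentLeft_eq_tentRight : tentLeft B 𝕜 0 B.l₀ = tentRight B 𝕜 0 B.l₀ := by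
  have hl : (B.l : 𝕜) ≠ 0 := by exact_mod_cast B.l_pos.ne'
  rw [tentLeft, tentRight, if_pos rfl, if_pos rfl]
  field_simp
  ring

theorem tentLeft_sub_tentRight : tentLeft B 𝕜 1 B.l₀ - tentRight B 𝕜 1 B.l₀ = 1 := by
  have hl : (B.l : 𝕜) ≠ 0 := by exact_mod_cast B.l_pos.ne'
  simp only [tentLeft, tentRight, one_ne_zero, if_true, if_false]
  field_simp
  ring

theorem tent_eq_left {x : ℝ} (hx : x ≤ B.l₀) : tent B 𝕜 x = tentLeft B 𝕜 0 x := by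
  have hl := B.l_pos
  rw [tent, tentLeft, min_eq_left]
  · simp
  · rw [div_mul_eq_mul_div, div_mul_eq_mul_div, div_le_div_iff_of_pos_right hl]
    linarith [mul_le_mul_of_nonneg_left hx hl.le]

theorem tent_eq_right {x : ℝ} (hx : B.l₀ ≤ x) : tent B 𝕜 x = tentRight B 𝕜 0 x := by
  have hl := B.l_pos
  have hl' : (B.l : 𝕜) ≠ 0 := by exact_mod_cast hl.ne'
  rw [tent, tentRight, min_eq_right, if_pos rfl]
  · push_cast
    field_simp
    ring
  · rw [div_mul_eq_mul_div, div_mul_eq_mul_div, div_le_div_iff_of_pos_right hl]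
    linarith [mul_le_mul_of_nonneg_left hx hl.le]

theorem d2u_ae_eq_tent {ξ : B.X 𝕜} (h : X.d2u ξ = memLp_tent.toLp (tent B 𝕜)) :
    X.d2u ξ =ᵐ[volume.restrict (Ioo 0 B.l₀)] tentLeft B 𝕜 0 ∧
      X.d2u ξ =ᵐ[volume.restrict (Ioo B.l₀ B.l)] tentRight B 𝕜 0 := by
  have hξ : X.d2u ξ =ᵐ[volume.restrict (Ioo 0 B.l)] tent B 𝕜 := by
    rw [h]
    exact memLp_tent.coeFn_toLp
  constructor
  · filter_upwards [ae_left hξ, ae_restrict_mem measurableSet_Ioo] with x hx hx'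
    rw [hx, tent_eq_left hx'.2.le]
  · filter_upwards [ae_right hξ, ae_restrict_mem measurableSet_Ioo] with x hx hx'
    rw [hx, tent_eq_right hx'.1.le]

/-- If `u''` has piecewise derivatives `z`, `w` of order up to two, then `u` is piecewise `H⁴`. -/
theorem isSobolev_of_d2u {ξ : B.X 𝕜} {d z w : ℕ → ℝ → 𝕜} (hd : IsH2Zero B.l (X.u ξ) d)
    (hz : IsSobolev 2 0 B.l₀ z) (hw : IsSobolev 2 B.l₀ B.l w)
    (hξz : X.d2u ξ =ᵐ[volume.restrict (Ioo 0 B.l₀)] z 0)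
    (hξw : X.d2u ξ =ᵐ[volume.restrict (Ioo B.l₀ B.l)] w 0) :
    IsSobolev 4 0 B.l₀ (fun j => if j < 2 then d j else z (j - 2)) ∧
      IsSobolev 4 B.l₀ B.l (fun j => if j < 2 then d j else w (j - 2)) :=
  ⟨(hd.sobolev.mono B.l_pos.le le_rfl B.l₀_lt.le).append hz
      ((show d 2 =ᵐ[_] _ from ae_left (X.d2u_ae_eq ξ hd).symm).trans hξz),
    (hd.sobolev.mono B.l_pos.le B.l₀_pos.le le_rfl).append hw
      ((show d 2 =ᵐ[_] _ from ae_right (X.d2u_ae_eq ξ hd).symm).trans hξw)⟩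

/-- A unit jump of `u'''` at `l₀` produces a nonpositive deflection there: by Green's formula the
deflection is `-‖tent‖²`. -/
theorem p_eq_of_d2u_eq_tent {ξ : B.X 𝕜} (h : X.d2u ξ = memLp_tent.toLp (tent B 𝕜)) :
    X.p ξ = ((-‖X.d2u ξ‖ ^ 2 : ℝ) : 𝕜) := by
  obtain ⟨d, hd, -⟩ := X.exists_rep ξ
  obtain ⟨hξa, hξb⟩ := d2u_ae_eq_tent h
  obtain ⟨ha, hb⟩ := isSobolev_of_d2u hd isSobolev_tentLeft isSobolev_tentRight hξa hξb
  have h0 := Lp.coeFn_zero 𝕜 2 (volume.restrict (Ioo 0 B.l))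
  have hg := inner_d2u_eq (ζ := ξ) (ξ := ξ) (h := 0) ha hb hξa hξb tentLeft_zero tentRight_l
    tentLeft_eq_tentRight (ae_left h0) (ae_right h0)
  have h3 : tentLeft B 𝕜 (3 - 2) B.l₀ - tentRight B 𝕜 (3 - 2) B.l₀ = 1 := tentLeft_sub_tentRight
  rw [inner_zero_right, zero_sub, if_neg (by norm_num), if_neg (by norm_num), h3, mul_one,
    inner_self_eq_norm_sq_to_K] at hg
  have hp := congrArg (starRingEnd 𝕜) hg
  rw [map_neg, RCLike.conj_conj, ← RCLike.ofReal_pow, RCLike.conj_ofReal] at hp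
  rw [RCLike.ofReal_neg, hp, neg_neg]

/-- `Ã` is surjective. Prescribing `Ã ξ = η` prescribes the velocities `v`, `q` of `ξ` and the
fourth derivative of `u` away from `l₀`. So `u''` is known up to a multiple `J` of `tent`, where
`J` is the jump of `u'''` at `l₀`, and the equation of motion of the shaker determines `J`. -/
theorem exists_mem_graph_closedLoop (η : B.X 𝕜) :
    ∃ ξ : B.X 𝕜, (ξ, η) ∈ (K.closedLoop 𝕜).graph := by
  have hEI := mul_pos B.E_pos B.I_pos
  have hκ := B.κ_pos
  have hm : (B.m : 𝕜) ≠ 0 := by exact_mod_cast B.m_pos.ne'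
  obtain ⟨ξ₁, hd₁, hv₁, hq₁⟩ := X.exists_of (B := B) (memLp_tent.toLp (tent B 𝕜)) 0 0
  -- The torques depend on the velocity only, so that any state with velocity `X.u η` yields them.
  obtain ⟨ξ₀, -, hv₀, -⟩ := X.exists_of (B := B) (0 : L2 𝕜 B.l) (X.u η) 0
  obtain ⟨z, dz, hz, hz2⟩ := IsH2Zero.exists_of_L2 B.l_pos (K.load ξ₀ (X.v η))
  obtain ⟨ξ₂, hd₂, hv₂, hq₂⟩ := X.exists_of (B := B) z (X.u η) (X.p η)
  have hp₁ := p_eq_of_d2u_eq_tent hd₁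
  have hdet : (B.E : 𝕜) * B.I - B.κ * X.p ξ₁ ≠ 0 := by
    have : 0 < B.E * B.I - B.κ * (-‖X.d2u ξ₁‖ ^ 2) := by
      rw [mul_neg, sub_neg_eq_add]
      positivity
    rw [hp₁]
    exact_mod_cast this.ne'
  set J : 𝕜 := ((B.m : 𝕜) * X.q η + B.κ * X.p ξ₂ + K.α₀ * X.p η)
    / ((B.E : 𝕜) * B.I - B.κ * X.p ξ₁) with hJ
  set ξ : B.X 𝕜 := ξ₂ + J • ξ₁ with hξ
  have hv : X.v ξ = X.u η := by rw [hξ, map_add, map_smul, hv₁, hv₂, smul_zero, add_zero]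
  have hq : X.q ξ = X.p η := by rw [hξ, map_add, map_smul, hq₁, hq₂, smul_zero, add_zero]
  have hp : X.p ξ = X.p ξ₂ + J * X.p ξ₁ := by rw [hξ, map_add, map_smul, smul_eq_mul]
  have hload : K.load ξ (X.v η) = dz 2 := by
    rw [hz2]
    simp only [load, torque_eq_inner, hv, hv₀]
  obtain ⟨hta, htb⟩ := d2u_ae_eq_tent hd₁
  have hd2 : X.d2u ξ = z + J • X.d2u ξ₁ := by rw [hξ, map_add, map_smul, hd₂]
  have hadd := Lp.coeFn_add z (J • X.d2u ξ₁)
  have hsmul := Lp.coeFn_smul J (X.d2u ξ₁)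
  have hξa : X.d2u ξ =ᵐ[volume.restrict (Ioo 0 B.l₀)] (dz + J • tentLeft B 𝕜) 0 := by
    rw [hd2]
    filter_upwards [ae_left hadd, ae_left hsmul, hta, ae_left hz.ae_eq] with x h1 h2 h3 h4
    rw [h1, Pi.add_apply, h2, Pi.smul_apply, h3, h4]
    rfl
  have hξb : X.d2u ξ =ᵐ[volume.restrict (Ioo B.l₀ B.l)] (dz + J • tentRight B 𝕜) 0 := by
    rw [hd2]
    filter_upwards [ae_right hadd, ae_right hsmul, htb, ae_right hz.ae_eq] with x h1 h2 h3 h4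
    rw [h1, Pi.add_apply, h2, Pi.smul_apply, h3, h4]
    rfl
  obtain ⟨d, hd, -⟩ := X.exists_rep ξ
  obtain ⟨hsa, hsb⟩ := isSobolev_of_d2u hd
    ((hz.sobolev.mono B.l_pos.le le_rfl B.l₀_lt.le).add B.l₀_pos.le (isSobolev_tentLeft.smul J))
    ((hz.sobolev.mono B.l_pos.le B.l₀_pos.le le_rfl).add B.l₀_lt.le (isSobolev_tentRight.smul J))
    hξa hξb
  obtain ⟨e, he, hpe⟩ := X.exists_rep η
  refine ⟨ξ, K.mem_graph_closedLoop.2 ⟨_, _, ⟨hsa, hsb, ae_left hd.ae_eq, ae_right hd.ae_eq, ?_, ?_,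
    ?_, e, by rwa [hv], by rw [hq, hpe]⟩, ⟨hv.symm, ?_, ?_, hq.symm, ?_⟩⟩⟩
  · simp [tentLeft_zero, hz.left]
  · simp [tentRight_l, hz.right]
  · simp [tentLeft_eq_tentRight]
  · filter_upwards [ae_left (K.coeFn_load ξ (X.v η))] with x hx
    refine (eq_fourth_deriv_iff _ _ _).2 (hx.symm.trans ?_)
    rw [hload]
    simp [tentLeft]
  · filter_upwards [ae_right (K.coeFn_load ξ (X.v η))] with x hx
    refine (eq_fourth_deriv_iff _ _ _).2 (hx.symm.trans ?_)
    rw [hload]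
    simp [tentRight]
  · have h3 : (dz + J • tentLeft B 𝕜) (3 - 2) B.l₀ - (dz + J • tentRight B 𝕜) (3 - 2) B.l₀ = J := by
      have := tentLeft_sub_tentRight (B := B) (𝕜 := 𝕜)
      simp only [Pi.add_apply, Pi.smul_apply, smul_eq_mul, Nat.reduceSub]
      linear_combination J * this
    rw [if_neg (by norm_num), if_neg (by norm_num), h3, hp, force, hq]
    have hJ' := div_mul_cancel₀ ((B.m : 𝕜) * X.q η + B.κ * X.p ξ₂ + K.α₀ * X.p η) hdet
    rw [← hJ] at hJ'
    rw [one_div, eq_inv_mul_iff_mul_eq₀ hm]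
    linear_combination -hJ'

theorem isMaximal_closedLoop : IsMaximal (K.closedLoop 𝕜) := by
  obtain ⟨C, hC, hbd⟩ := K.norm_le_norm_closedLoop (𝕜 := 𝕜)
  have hC1 : 0 < C + 1 := by linarith
  have hC' : ((C + 1 : ℝ) : 𝕜) ≠ 0 := by exact_mod_cast hC1.ne'
  refine ⟨C + 1, hC1, fun y => ?_⟩
  -- `x - (C + 1) Ã x = y` means `Ã x = (x - y) / (C + 1)`, a small perturbation of a solvable
  -- equation.
  obtain ⟨x, hx⟩ := exists_perturbed_preimage
    (H := fun x y : B.X 𝕜 => (x, y) ∈ (K.closedLoop 𝕜).graph) K.exists_mem_graph_closedLoop hC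
    (fun x y x' y' h h' => hbd _ _ ((K.closedLoop 𝕜).graph.sub_mem h h'))
    (c := ((C + 1 : ℝ) : 𝕜)⁻¹)
    (by
      rw [norm_inv, RCLike.norm_ofReal, abs_of_pos hC1, ← div_eq_mul_inv, div_lt_one hC1]
      linarith) (-((C + 1 : ℝ) : 𝕜)⁻¹ • y)
  obtain ⟨x', h1, h2⟩ := (LinearPMap.mem_graph_iff _).1 hx
  refine ⟨x', ?_⟩
  dsimp only at h1 h2
  rw [h1, h2, neg_smul, smul_add, smul_neg, smul_inv_smul₀ hC', smul_inv_smul₀ hC']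
  abel

end Feedback

end Beam

end ShakerBeam

end

theorem mainTheorem3 (𝕜 : Type*) [RCLike 𝕜] (B : ShakerBeam.Beam) (k : ℕ) (K : B.Feedback k) :
    Dense ((K.closedLoop 𝕜).domain : Set (B.X 𝕜)) ∧
    (K.closedLoop 𝕜).IsClosed ∧
    ShakerBeam.IsDissipative (K.closedLoop 𝕜) ∧
    ShakerBeam.IsMaximal (K.closedLoop 𝕜) ∧
    (∃ T : ShakerBeam.C0Semigroup 𝕜 (B.X 𝕜), T.IsGenerator (K.closedLoop 𝕜)) ∧
    ShakerBeam.IsWellPosed (K.closedLoop 𝕜) := by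
  have hD := K.isDissipative_closedLoop (𝕜 := 𝕜)
  have hM := K.isMaximal_closedLoop (𝕜 := 𝕜)
  obtain ⟨R, hR⟩ := hD.exists_isResolvent hM one_pos
  exact ⟨hD.dense_domain hM, hR.isClosed one_pos, hD, hM, hD.exists_isGenerator_and_isWellPosed hM⟩
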